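/- Let $L^2=L^2(0,1)$, let $e_0=1$, write $\bar h=\int_0^1 h\,d\theta$, and let $A=\frac{d^2}{d\theta^2}$ be the Neumann Laplacian on $L^2$, with domain $D(A)=\{h\in W^{2,2}(0,1): h'(0)=h'(1)=0\}$. Let $(-A)^{-1}$ denote its inverse on functions of zero average, extended by $0$ to constants: $u=(-A)^{-1}h$ is the unique $u\in D(A)$ with $-Au=h-\bar h$ and $\bar u=0$. For $c\in\mathbb R$ let $\mu_c=\mathcal N(c\,e_0,(-A)^{-1})$ be the Gaussian measure on $L^2$ with mean $c\,e_0$ and covariance operator $(-A)^{-1}$. Fix $\lambda\in\mathbb R$ and set $$F(x)=(1+x)\ln(1+x)+(1-x)\ln(1-x)-\tfrac{\lambda}{2}x^2\quad(-1\le x\le 1,\ 0\ln 0=0),$$ $$F^n(x)=2\sum_{k=0}^{n}\frac{x^{2k+2}}{(2k+2)(2k+1)}-\tfrac{\lambda}{2}x^2\quad(x\in\mathbb R),$$ $$K=\{x\in L^2:\ -1\le x\le 1 \text{ a.e.}\},\qquad U^n(x)=\int_0^1F^n(x(\theta))\,d\theta\in(-\infty,+\infty],$$ $U(x)=\int_0^1F(x(\theta))\,d\theta$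 for $x\in K$ and $U(x)=+\infty$ otherwise. Proposition. Let $-1<c<1$. Then $\mu_c$ exists, $\mu_c(K)>0$, the normalization constants $Z^n_c=\int e^{-U^n}d\mu_c$ (for $n\ge 1$) and $Z_c=\int_K e^{-U}d\mu_c$ are positive and finite, and the probability measures $$\nu^n_c(dx)=\frac1{Z^n_c}e^{-U^n(x)}\mu_c(dx)$$ converge weakly on $L^2$, as $n\to\infty$, to $$\nu_c(dx)=\frac1{Z_c}e^{-U(x)}\mathbf 1_{x\in K}\,\mu_c(dx),$$ that is, $\int\psi\,d\nu^n_c\to\int\psi\,d\nu_c$ for every bounded continuous $\psi:L^2\to\mathbb R$. -/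

import Mathlib

open MeasureTheory ProbabilityTheory Set Filter Topology
open scoped ENNReal RealInnerProductSpace BoundedContinuousFunction

noncomputable section

namespace CahnHilliard

/-- Lebesgue measure on the interval `(0,1)`. -/
abbrev leb : Measure ℝ := volume.restrict (Ioo (0 : ℝ) 1)

/-- The Hilbert space `L²(0,1)`. -/
abbrev L2 : Type := Lp ℝ 2 leb

instance : MeasurableSpace L2 := borel L2

instance : BorelSpace L2 := ⟨rfl⟩

/-! ### Gaussian measures on a Hilbert space -/

section Gaussian

variable {E : Type*} [NormedAddCommGroup E] [InnerProductSpace ℝ E]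
  [MeasurableSpace E] [BorelSpace E]

/-- `μ` is the Gaussian measure `N(m, Q)`: it is Gaussian, with mean `m` and covariance operator
`Q` (the centred covariance of `⟨h, ·⟩` and `⟨k, ·⟩` is `⟨Q h, k⟩`). -/
structure IsGaussianWith (m : E) (Q : E → E) (μ : Measure E) : Prop where
  isGaussian : IsGaussian μ
  mean_eq : ∫ x, x ∂μ = m
  cov_eq : ∀ h k : E, covarianceBilin μ h k = ⟪Q h, k⟫

/-- There is at most one measure `N(m, Q)`. -/
theorem IsGaussianWith.unique [CompleteSpace E] [SecondCountableTopology E]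
    {m : E} {Q : E → E} {μ ν : Measure E}
    (hμ : IsGaussianWith m Q μ) (hν : IsGaussianWith m Q ν) : μ = ν := by
  have key : ∀ {ρ : Measure E}, IsGaussianWith m Q ρ → ∀ t : E,
      charFun ρ t = Complex.exp ((⟪t, m⟫ : ℝ) * Complex.I - (⟪Q t, t⟫ : ℝ) / 2) := by
    intro ρ hρ t
    have := hρ.isGaussian
    rw [IsGaussian.charFun_eq t, ← covarianceBilin_self IsGaussian.memLp_two_id t, hρ.cov_eq,
      ← hρ.mean_eq, integral_complex_ofReal]
    congr 4
    exact integral_inner IsGaussian.integrable_id t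
  have := hμ.isGaussian
  have := hν.isGaussian
  refine Measure.ext_of_charFun ?_
  ext t
  rw [key hμ, key hν]

open Classical in
/-- The Gaussian measure `N(m, Q)` (and `0` if there is no such measure). -/
def gaussian (m : E) (Q : E → E) : Measure E :=
  if h : ∃ μ : Measure E, IsGaussianWith m Q μ then h.choose else 0

end Gaussian

/-! ### The Neumann Laplacian -/

/-- The average of `h ∈ L²(0,1)`. -/
def mean (h : L2) : ℝ := ∫ θ, h θ ∂leb

/-- The constant function `a = a e₀` in `L²(0,1)`, where `e₀ = 1`. -/
def constL2 (a : ℝ) : L2 := Lp.const 2 leb a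

/-- `u ∈ D(A)` and `A u = g`, where `A` is the Laplacian with Neumann boundary condition,
`D(A) = {u ∈ W^{2,2}(0,1) : u'(0) = u'(1) = 0}`. A function `u` lies in `W^{2,2}(0,1)` with
`u'' = g ∈ L²(0,1)` iff it has a version `U` which is a primitive on `[0,1]` of a function
`V` (`= u'`) which is itself a primitive on `[0,1]` of `g`. -/
def IsNeumannLaplacian (u g : L2) : Prop :=
  ∃ U V : ℝ → ℝ, (∀ᵐ θ ∂leb, u θ = U θ) ∧
    (∀ θ ∈ Icc (0 : ℝ) 1, U θ = U 0 + ∫ s in (0 : ℝ)..θ, V s) ∧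
    (∀ θ ∈ Icc (0 : ℝ) 1, V θ = V 0 + ∫ s in (0 : ℝ)..θ, g s) ∧
    V 0 = 0 ∧ V 1 = 0

theorem integrable_L2 (h : L2) : Integrable (h : ℝ → ℝ) leb :=
  (Lp.memLp h).integrable (by norm_num)

theorem intervalIntegral_congr_leb {f g : ℝ → ℝ} (h : ∀ᵐ s ∂leb, f s = g s) {θ : ℝ}
    (hθ : θ ∈ Icc (0 : ℝ) 1) : ∫ s in (0 : ℝ)..θ, f s = ∫ s in (0 : ℝ)..θ, g s := by
  rw [intervalIntegral.integral_of_le hθ.1, intervalIntegral.integral_of_le hθ.1,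
    integral_Ioc_eq_integral_Ioo, integral_Ioc_eq_integral_Ioo]
  refine integral_congr_ae ?_
  exact ae_mono (Measure.restrict_mono (Ioo_subset_Ioo_right hθ.2) le_rfl) h

/-- `-A` is invertible on functions of zero average. -/
theorem existsUnique_negLapInv (h : L2) :
    ∃! u : L2, IsNeumannLaplacian u (-(h - constL2 (mean h))) ∧ mean u = 0 := by
  set g : L2 := -(h - constL2 (mean h)) with hg
  have hgint := integrable_L2 g
  have hg0 : ∫ s, g s ∂leb = 0 := by
    have e : (g : ℝ → ℝ) =ᵐ[leb] fun s => mean h - h s := by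
      filter_upwards [Lp.coeFn_neg (h - constL2 (mean h)), Lp.coeFn_sub h (constL2 (mean h)),
        Lp.coeFn_const (p := 2) (μ := leb) (mean h)] with s h1 h2 h3
      have h3' : (constL2 (mean h)) s = mean h := by simpa [constL2] using h3
      rw [hg, h1, Pi.neg_apply, h2, Pi.sub_apply, h3']; ring
    rw [integral_congr_ae e, integral_sub (integrable_const _) (integrable_L2 h)]
    simp [mean, Measure.real]
  set g' : ℝ → ℝ := (Ioo (0 : ℝ) 1).indicator g with hg'
  have hg'int : Integrable g' := (integrable_indicator_iff measurableSet_Ioo).2 hgint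
  have hgg' : ∀ᵐ s ∂leb, g' s = g s := by
    filter_upwards [ae_restrict_mem measurableSet_Ioo] with s hs
    simp [hg', hs]
  set V : ℝ → ℝ := fun θ => ∫ s in (0 : ℝ)..θ, g' s with hV
  have hVc : Continuous V :=
    intervalIntegral.continuous_primitive (fun a b => hg'int.intervalIntegrable) 0
  set W : ℝ → ℝ := fun θ => ∫ s in (0 : ℝ)..θ, V s with hW
  have hWc : Continuous W :=
    intervalIntegral.continuous_primitive (fun a b => hVc.intervalIntegrable a b) 0
  set U : ℝ → ℝ := fun θ => W θ - ∫ s, W s ∂leb with hU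
  have hUc : Continuous U := hWc.sub continuous_const
  have hmem : ∀ {F : ℝ → ℝ}, Continuous F → MemLp F 2 leb := by
    intro F hF
    obtain ⟨C, hC⟩ := (isCompact_Icc (a := (0 : ℝ)) (b := 1)).exists_bound_of_continuousOn
      hF.continuousOn
    refine MemLp.of_bound hF.aestronglyMeasurable C ?_
    filter_upwards [ae_restrict_mem measurableSet_Ioo] with s hs
    exact hC s (Ioo_subset_Icc_self hs)
  refine ⟨(hmem hUc).toLp U, ⟨⟨U, V, (hmem hUc).coeFn_toLp, ?_, ?_, ?_, ?_⟩, ?_⟩, ?_⟩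
  · intro θ _
    simp [hU, hW]; ring
  · intro θ hθ
    rw [← intervalIntegral_congr_leb hgg' hθ]
    simp [hV]
  · simp [hV]
  · have := intervalIntegral_congr_leb hgg' (θ := 1) (by simp)
    rw [hV]; simp only
    rw [this, intervalIntegral.integral_of_le zero_le_one, integral_Ioc_eq_integral_Ioo, hg0]
  · rw [mean, integral_congr_ae (hmem hUc).coeFn_toLp, hU]
    rw [integral_sub ((hmem hWc).integrable (by norm_num)) (integrable_const _)]
    simp [Measure.real]
  · rintro u ⟨⟨U₂, V₂, hu, hU₂, hV₂, h0, h1⟩, hm⟩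
    have hVV : ∀ θ ∈ Icc (0 : ℝ) 1, V₂ θ = V θ := by
      intro θ hθ
      rw [hV₂ θ hθ, h0, ← intervalIntegral_congr_leb hgg' hθ, zero_add]
    have hUW : ∀ θ ∈ Icc (0 : ℝ) 1, U₂ θ = U₂ 0 + W θ := by
      intro θ hθ
      rw [hU₂ θ hθ, hW]
      congr 1
      refine intervalIntegral.integral_congr fun s hs => ?_
      rw [uIcc_of_le hθ.1] at hs
      exact hVV s ⟨hs.1, hs.2.trans hθ.2⟩
    have hue : (u : ℝ → ℝ) =ᵐ[leb] fun θ => U₂ 0 + W θ := by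
      filter_upwards [hu, ae_restrict_mem measurableSet_Ioo] with s hs hs'
      rw [hs, hUW s (Ioo_subset_Icc_self hs')]
    have hconst : U₂ 0 = -∫ s, W s ∂leb := by
      rw [mean, integral_congr_ae hue,
        integral_add (integrable_const _) ((hmem hWc).integrable (by norm_num))] at hm
      simp [Measure.real] at hm
      linarith
    refine Lp.ext ?_
    filter_upwards [hue, (hmem hUc).coeFn_toLp] with s hs hs'
    rw [hs, hs', hconst, hU]; ring

/-- The operator `(-A)⁻¹` on functions of zero average, extended by `0` to constants:
`u = (-A)⁻¹ h` is the solution of zero average of `-A u = h - mean h`. -/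
def negLapInv (h : L2) : L2 := (existsUnique_negLapInv h).choose

theorem negLapInv_spec (h : L2) :
    IsNeumannLaplacian (negLapInv h) (-(h - constL2 (mean h))) ∧ mean (negLapInv h) = 0 :=
  (existsUnique_negLapInv h).choose_spec.1

/-- The measure `μ_c = N(c e₀, (-A)⁻¹)` on `L²(0,1)`. -/
def mu (c : ℝ) : Measure L2 := gaussian (constL2 c) negLapInv

/-! ### Potentials and Gibbs measures -/

/-- `F(x) = (1+x) ln(1+x) + (1-x) ln(1-x) - (λ/2) x²`, used on `[-1,1]` only; the value at `±1` is
the continuous extension, since `0 * Real.log 0 = 0`. -/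
def F (lam x : ℝ) : ℝ :=
  (1 + x) * Real.log (1 + x) + (1 - x) * Real.log (1 - x) - lam / 2 * x ^ 2

/-- `Fⁿ(x) = 2 ∑_{k=0}^n x^{2k+2} / ((2k+2)(2k+1)) - (λ/2) x²`. -/
def Fn (lam : ℝ) (n : ℕ) (x : ℝ) : ℝ :=
  2 * ∑ k ∈ Finset.range (n + 1), x ^ (2 * k + 2) / ((2 * (k : ℝ) + 2) * (2 * (k : ℝ) + 1))
    - lam / 2 * x ^ 2

/-- `K = {x ∈ L²(0,1) : -1 ≤ x ≤ 1 a.e.}`. -/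
def K : Set L2 := {x | ∀ᵐ θ ∂leb, -1 ≤ x θ ∧ x θ ≤ 1}

open Classical in
/-- `Uⁿ(x) = ∫₀¹ Fⁿ(x(θ)) dθ ∈ (-∞, +∞]`. As `Fⁿ` is bounded below by a multiple of `-x²` and
`x ∈ L²(0,1)`, the integral is `+∞` exactly when `Fⁿ(x(·))` is not integrable. -/
def Un (lam : ℝ) (n : ℕ) (x : L2) : EReal :=
  if Integrable (fun θ => Fn lam n (x θ)) leb then ((∫ θ, Fn lam n (x θ) ∂leb : ℝ) : EReal) else ⊤

open Classical in
/-- `U(x) = ∫₀¹ F(x(θ)) dθ` if `x ∈ K`, and `+∞` otherwise. -/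
def U (lam : ℝ) (x : L2) : EReal :=
  if x ∈ K then ((∫ θ, F lam (x θ) ∂leb : ℝ) : EReal) else ⊤

/-- The measure `Z⁻¹ w μ`, with normalization constant `Z = ∫ w dμ`. It is a probability measure
exactly when `0 < Z < ∞`. -/
def normalized (μ : Measure L2) (w : L2 → ℝ≥0∞) : Measure L2 :=
  (∫⁻ x, w x ∂μ)⁻¹ • μ.withDensity w

/-- `νⁿ_c = (1/Zⁿ_c) exp(-Uⁿ) μ_c`. -/
def nuN (lam c : ℝ) (n : ℕ) : Measure L2 :=
  normalized (mu c) fun x => EReal.exp (-Un lam n x)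

/-- `ν_c = (1/Z_c) exp(-U) 1_K μ_c`. -/
def nu (lam c : ℝ) : Measure L2 :=
  normalized (mu c) (K.indicator fun x => EReal.exp (-U lam x))

end CahnHilliard

end

/-!
The measure `N(c, (-A)⁻¹)` is the law of the random series `c + ∑ ξₙ eₙ`, where the `ξₙ` are
independent standard normal variables and `eₙ` is the `n`-th Faber–Schauder function minus its
average (`schauderL2`): this is the Lévy–Ciesielski construction of Brownian motion, centred. With
`V_h = flux h` the derivative of `(-A)⁻¹ h`, integration by parts gives
`⟪(-A)⁻¹ h, k⟫ = ∫ V_h V_k` (`inner_negLapInv`) and identifies `⟪eₙ, h⟫` with the `n`-th Haar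
coefficient of `V_h` (`inner_schauderL2_level`). Parseval's identity for the Haar system then reads
`∑ ⟪eₙ, h⟫² = ⟪(-A)⁻¹ h, h⟫` (`tendsto_sum_inner_schauderL2_sq`), which is the covariance of the
series, and characteristic functions show that the limit is Gaussian (`isGaussianWith_map_series`).

Convergence and positivity of `K` both come from the constraints `|ξₙ| ≤ ε 2 ^ (j / 4)` for
`2 ^ j ≤ n < 2 ^ (j + 1)`. Their failure probabilities are summable, so almost surely all but
finitely many of them hold, and with positive probability all of them hold
(`stdGaussianSeq_box_pos`). At each point at most one function of level `j` is nonzero, and it is of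
size `2 ^ (-j / 2)`; so under the constraints the series converges uniformly and its sum is of order
`ε`. For small `ε` the series therefore stays within `1 - |c|` of `c`, so that `K` has positive
measure (`mu_K_pos`).

For the weak convergence, `Fⁿ` increases to `F` on `[-1, 1]` and to `+∞` outside, and for `n ≥ 1` it
is bounded below uniformly in `n`. By monotone convergence `exp (-Uⁿ)` tends pointwise to
`1_K exp (-U)` (`tendsto_expNeg_energy`). The weights are uniformly bounded and the limiting one has
positive mass, so dominated convergence concludes (`tendsto_integral_normalized`). Measurability of
the weights follows from the lower semicontinuity of `∫ Fⁿ(x(θ)) dθ` on `L²`.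
-/

noncomputable section

namespace CahnHilliard

/-! ### Gaussian random series in a Hilbert space -/

/-- The law of a sequence of independent standard normal variables. -/
abbrev stdGaussianSeq : Measure (ℕ → ℝ) := Measure.infinitePi fun _ : ℕ => gaussianReal 0 1

section Series

variable {E : Type*} [NormedAddCommGroup E] [InnerProductSpace ℝ E]
  [SecondCountableTopology E] [MeasurableSpace E] [BorelSpace E]

/-- The characteristic function of a finite random sum `∑ ξₙ eₙ`. -/
theorem integral_exp_inner_sum (e : ℕ → E) (t : E) (s : Finset ℕ) :
    ∫ ω, Complex.exp ((⟪∑ n ∈ s, ω n • e n, t⟫ : ℝ) * Complex.I) ∂stdGaussianSeq =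
      Complex.exp (-((∑ n ∈ s, ⟪e n, t⟫ ^ 2 : ℝ) : ℂ) / 2) := by
  have hm : ∀ n ∈ s, AEMeasurable (fun ω : ℕ → ℝ => ω n • e n) stdGaussianSeq := fun n _ => by
    have : Measurable fun ω : ℕ → ℝ => ω n • e n := (measurable_pi_apply n).smul_const (e n)
    exact this.aemeasurable
  have hind : iIndepFun (fun n (ω : ℕ → ℝ) => ω n • e n) stdGaussianSeq :=
    iIndepFun_infinitePi (X := fun n (x : ℝ) => x • e n)
      fun n => measurable_id.smul_const (e n)
  have key := congrFun (iIndepFun.charFun_map_fun_finsetSum_eq_prod hm (hind.restrict _)) t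
  rw [charFun_apply, integral_map] at key
  · rw [key, Finset.prod_apply]
    have h1 : ∀ n, charFun (stdGaussianSeq.map fun ω => ω n • e n) t =
        Complex.exp (-((⟪e n, t⟫ ^ 2 : ℝ) : ℂ) / 2) := by
      intro n
      have h2 : stdGaussianSeq.map (fun ω => ω n • e n) =
          (gaussianReal 0 1).map (fun x => x • e n) := by
        have hs : Measurable fun x : ℝ => x • e n := measurable_id'.smul_const (e n)
        conv_rhs => rw [← Measure.infinitePi_map_eval (fun _ : ℕ => gaussianReal 0 1) n]
        rw [Measure.map_map hs (measurable_pi_apply n)]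
        rfl
      have h3 := charFun_gaussianReal (μ := 0) (v := 1) ⟪e n, t⟫
      rw [h2, charFun_apply, integral_map]
      · rw [charFun_apply] at h3
        simp only [real_inner_smul_left]
        convert h3 using 2
        · ext x; simp; ring_nf
        · simp [neg_div]
      · exact (measurable_id.smul_const (e n)).aemeasurable
      · exact Continuous.aestronglyMeasurable (by fun_prop)
    simp_rw [h1]
    rw [← Complex.exp_sum]
    congr 1
    push_cast
    rw [neg_div, Finset.sum_div, ← Finset.sum_neg_distrib]
    exact Finset.sum_congr rfl fun n _ => by ring
  · exact Finset.aemeasurable_fun_sum s hm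
  · exact Continuous.aestronglyMeasurable (by fun_prop)

variable [CompleteSpace E]

/-- A measure whose characteristic function is that of `N(m, Q)` is `N(m, Q)`, provided the
quadratic form of `Q` polarizes. -/
theorem isGaussianWith_of_charFun {m : E} {Q : E → E} {μ : Measure E} [IsProbabilityMeasure μ]
    (hsmul : ∀ (a : ℝ) h, ⟪Q (a • h), a • h⟫ = a ^ 2 * ⟪Q h, h⟫)
    (hadd : ∀ h k, ⟪Q (h + k), h + k⟫ = ⟪Q h, h⟫ + 2 * ⟪Q h, k⟫ + ⟪Q k, k⟫)
    (hnonneg : ∀ h, 0 ≤ ⟪Q h, h⟫)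
    (hμ : ∀ t, charFun μ t =
      Complex.exp ((⟪m, t⟫ : ℝ) * Complex.I - ((⟪Q t, t⟫ : ℝ) : ℂ) / 2)) :
    IsGaussianWith m Q μ := by
  have hmap : ∀ t, μ.map (fun x => ⟪t, x⟫) = gaussianReal ⟪m, t⟫ ⟪Q t, t⟫.toNNReal := by
    intro t
    have hc : Continuous fun x : E => ⟪t, x⟫ := by fun_prop
    have := Measure.isProbabilityMeasure_map (μ := μ) hc.measurable.aemeasurable
    refine Measure.ext_of_charFun ?_
    ext s
    have h1 := hμ (s • t)
    rw [charFun_apply] at h1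
    rw [charFun_gaussianReal, charFun_apply, integral_map hc.measurable.aemeasurable
      (Continuous.aestronglyMeasurable (by fun_prop)), Real.coe_toNNReal _ (hnonneg t)]
    rw [hsmul] at h1
    convert h1 using 2
    · ext x; rw [real_inner_smul_right, real_inner_comm t x]; simp [mul_comm]
    · rw [real_inner_smul_right]; push_cast; ring
  have hG : IsGaussian μ := by
    refine isGaussian_of_map_eq_gaussianReal fun L => ?_
    have := hmap ((InnerProductSpace.toDual ℝ E).symm L)
    simp only [InnerProductSpace.toDual_symm_apply] at this
    exact ⟨_, _, this⟩
  have hint : ∀ t, ∫ x, ⟪t, x⟫ ∂μ = ⟪m, t⟫ := by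
    intro t
    have hc : Continuous fun x : E => ⟪t, x⟫ := by fun_prop
    have := integral_map (μ := μ) hc.measurable.aemeasurable
      (f := fun x : ℝ => x) (Continuous.aestronglyMeasurable (by fun_prop))
    rw [← this, hmap t, integral_id_gaussianReal]
  have hself : ∀ t, covarianceBilin μ t t = ⟪Q t, t⟫ := by
    intro t
    have hc : Continuous fun x : E => ⟪t, x⟫ := by fun_prop
    rw [covarianceBilin_self IsGaussian.memLp_two_id,
      ← variance_id_map hc.measurable.aemeasurable, hmap t, variance_id_gaussianReal,
      Real.coe_toNNReal _ (hnonneg t)]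
  refine ⟨hG, ?_, fun h k => ?_⟩
  · refine ext_inner_left ℝ fun t => ?_
    rw [real_inner_comm m, ← hint t]
    exact (integral_inner IsGaussian.integrable_id t).symm
  · have h1 := hself (h + k)
    rw [hadd, map_add, map_add, add_apply, add_apply, hself h, hself k,
      covarianceBilin_comm k h] at h1
    linarith

/-- An almost surely convergent random series `m + ∑ ξₙ eₙ` with independent standard normal
coefficients has law `N(m, Q)` when `⟪Q t, t⟫ = ∑ ⟪eₙ, t⟫²`. Only the partial sums of length `N J`
are assumed to converge. -/
theorem isGaussianWith_map_series {m : E} {Q : E → E} {e : ℕ → E} {N : ℕ → ℕ}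
    {X : (ℕ → ℝ) → E} (hX : Measurable X)
    (hlim : ∀ᵐ ω ∂stdGaussianSeq,
      Tendsto (fun J => ∑ n ∈ Finset.range (N J), ω n • e n) atTop (𝓝 (X ω)))
    (hQ : ∀ t, Tendsto (fun J => ∑ n ∈ Finset.range (N J), ⟪e n, t⟫ ^ 2) atTop (𝓝 ⟪Q t, t⟫))
    (hsmul : ∀ (a : ℝ) h, ⟪Q (a • h), a • h⟫ = a ^ 2 * ⟪Q h, h⟫)
    (hadd : ∀ h k, ⟪Q (h + k), h + k⟫ = ⟪Q h, h⟫ + 2 * ⟪Q h, k⟫ + ⟪Q k, k⟫) :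
    IsGaussianWith m Q (stdGaussianSeq.map fun ω => m + X ω) := by
  have hmX : Measurable fun ω => m + X ω := hX.const_add m
  have := Measure.isProbabilityMeasure_map (μ := stdGaussianSeq) hmX.aemeasurable
  refine isGaussianWith_of_charFun hsmul hadd
    (fun h => ge_of_tendsto' (hQ h) fun J => Finset.sum_nonneg fun n _ => sq_nonneg _) fun t => ?_
  rw [charFun_apply, integral_map hmX.aemeasurable
    (Continuous.aestronglyMeasurable (by fun_prop))]
  have h1 : Tendsto (fun J => ∫ ω, Complex.exp
      ((⟪∑ n ∈ Finset.range (N J), ω n • e n, t⟫ : ℝ) * Complex.I) ∂stdGaussianSeq) atTop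
      (𝓝 (∫ ω, Complex.exp ((⟪X ω, t⟫ : ℝ) * Complex.I) ∂stdGaussianSeq)) := by
    refine tendsto_integral_of_dominated_convergence (fun _ => 1) (fun J => ?_)
      (integrable_const _) (fun J => ?_) ?_
    · have hc : Continuous fun x : E => Complex.exp ((⟪x, t⟫ : ℝ) * Complex.I) := by fun_prop
      refine (hc.measurable.comp ?_).aestronglyMeasurable
      exact Finset.measurable_fun_sum _ fun n _ => (measurable_pi_apply n).smul_const (e n)
    · exact Eventually.of_forall fun ω => by rw [Complex.norm_exp_ofReal_mul_I]
    · filter_upwards [hlim] with ω hω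
      have hc : Continuous fun x : E => Complex.exp ((⟪x, t⟫ : ℝ) * Complex.I) := by fun_prop
      exact (hc.tendsto _).comp hω
  simp_rw [integral_exp_inner_sum] at h1
  have h2 : Tendsto (fun J => Complex.exp
      (-((∑ n ∈ Finset.range (N J), ⟪e n, t⟫ ^ 2 : ℝ) : ℂ) / 2)) atTop
      (𝓝 (Complex.exp (-((⟪Q t, t⟫ : ℝ) : ℂ) / 2))) := by
    have hc : Continuous fun x : ℝ => Complex.exp (-(x : ℂ) / 2) := by fun_prop
    exact (hc.tendsto _).comp (hQ t)
  have h3 := tendsto_nhds_unique h1 h2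
  have h4 : ∀ ω, Complex.exp ((⟪m + X ω, t⟫ : ℝ) * Complex.I) =
      Complex.exp ((⟪m, t⟫ : ℝ) * Complex.I) * Complex.exp ((⟪X ω, t⟫ : ℝ) * Complex.I) := by
    intro ω
    rw [← Complex.exp_add, inner_add_left]
    push_cast
    ring_nf
  simp_rw [h4]
  rw [integral_const_mul, h3, ← Complex.exp_add]
  ring_nf

end Series

/-! ### Boxes under the law of a Gaussian sequence -/

theorem gaussianReal_abs_le_pos {a : ℝ} (ha : 0 < a) :
    0 < gaussianReal 0 1 {x : ℝ | |x| ≤ a} := by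
  have h : volume ≪ gaussianReal 0 1 := gaussianReal_absolutelyContinuous' 0 one_ne_zero
  refine pos_iff_ne_zero.2 fun h0 => ?_
  have := h h0
  have e : {x : ℝ | |x| ≤ a} = Icc (-a) a := by ext; simp [abs_le]
  rw [e, Real.volume_Icc] at this
  simp at this
  linarith

/-- Markov's inequality for the eighth moment. -/
theorem exists_gaussianReal_abs_gt_le : ∃ M : ℝ, 0 ≤ M ∧ ∀ a : ℝ, 0 < a →
    gaussianReal 0 1 {x : ℝ | a < |x|} ≤ ENNReal.ofReal (M / a ^ 8) := by
  have hM : MemLp (id : ℝ → ℝ) 8 (gaussianReal 0 1) := memLp_id_gaussianReal' 8 (by simp)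
  have hint : Integrable (fun x : ℝ => x ^ 8) (gaussianReal 0 1) := by
    have := hM.integrable_norm_pow (p := 8) (by norm_num)
    refine this.congr (Eventually.of_forall fun x => ?_)
    simp [Even.pow_abs (by decide : Even 8)]
  refine ⟨∫ x, x ^ 8 ∂gaussianReal 0 1, integral_nonneg fun x => by positivity, fun a ha => ?_⟩
  have h1 := mul_meas_ge_le_integral_of_nonneg (μ := gaussianReal 0 1)
    (f := fun x : ℝ => x ^ 8) (Eventually.of_forall fun x => by positivity) hint (a ^ 8)
  have h2 : (gaussianReal 0 1).real {x : ℝ | a < |x|} ≤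
      (gaussianReal 0 1).real {x : ℝ | a ^ 8 ≤ x ^ 8} := by
    refine measureReal_mono fun x hx => ?_
    have : a ^ 8 ≤ |x| ^ 8 := pow_le_pow_left₀ ha.le (le_of_lt hx) 8
    rwa [Even.pow_abs (by decide : Even 8)] at this
  rw [← ofReal_measureReal]
  refine ENNReal.ofReal_le_ofReal ?_
  rw [le_div_iff₀ (by positivity)]
  nlinarith [pow_pos ha 8]

theorem stdGaussianSeq_eval_preimage (n : ℕ) {s : Set ℝ} (hs : MeasurableSet s) :
    stdGaussianSeq {ω | ω n ∈ s} = gaussianReal 0 1 s := by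
  conv_rhs => rw [← Measure.infinitePi_map_eval (fun _ : ℕ => gaussianReal 0 1) n,
    Measure.map_apply (measurable_pi_apply n) hs]
  rfl

variable {a : ℕ → ℝ}

/-- By the Borel–Cantelli lemma. -/
theorem ae_eventually_abs_le
    (hsum : ∑' n, gaussianReal 0 1 {x : ℝ | a n < |x|} ≠ ∞) :
    ∀ᵐ ω ∂stdGaussianSeq, ∀ᶠ n in atTop, |ω n| ≤ a n := by
  have hm : ∀ n, MeasurableSet {x : ℝ | a n < |x|} := fun n =>
    measurableSet_lt measurable_const measurable_id.abs
  have := ae_eventually_notMem (μ := stdGaussianSeq) (s := fun n => {ω | ω n ∈ {x : ℝ | a n < |x|}})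
    (by simpa only [stdGaussianSeq_eval_preimage _ (hm _)] using hsum)
  filter_upwards [this] with ω hω
  filter_upwards [hω] with n hn
  simpa using hn

/-- Infinitely many independent constraints of summable failure probability, each of positive
probability, hold simultaneously with positive probability. -/
theorem stdGaussianSeq_box_pos (ha : ∀ n, 0 < a n)
    (hsum : ∑' n, gaussianReal 0 1 {x : ℝ | a n < |x|} ≠ ∞) :
    0 < stdGaussianSeq {ω | ∀ n, |ω n| ≤ a n} := by
  have hm : ∀ n, MeasurableSet {x : ℝ | |x| ≤ a n} := fun n =>
    measurableSet_le measurable_id.abs measurable_const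
  have e : {ω : ℕ → ℝ | ∀ n, |ω n| ≤ a n} = Set.univ.pi fun n => {x : ℝ | |x| ≤ a n} := by
    ext; simp
  rw [e, Measure.infinitePi_pi_univ _ hm]
  set p : ℕ → ℝ := fun n => (gaussianReal 0 1).real {x : ℝ | a n < |x|} with hp
  have hps : Summable p := ENNReal.summable_toReal hsum
  have hq : ∀ n, gaussianReal 0 1 {x : ℝ | |x| ≤ a n} = ENNReal.ofReal (1 - p n) := by
    intro n
    have : {x : ℝ | |x| ≤ a n} = {x : ℝ | a n < |x|}ᶜ := by ext; simp
    rw [← ofReal_measureReal, this, probReal_compl_eq_one_sub]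
    exact measurableSet_lt measurable_const measurable_id.abs
  have hp1 : ∀ n, p n < 1 := by
    intro n
    have := gaussianReal_abs_le_pos (ha n)
    rw [hq, ENNReal.ofReal_pos] at this
    linarith
  have hmul : Multipliable fun n => 1 + -p n :=
    Real.multipliable_one_add_of_summable hps.neg
  have hprod : HasProd (fun n => gaussianReal 0 1 {x : ℝ | |x| ≤ a n})
      (ENNReal.ofReal (∏' n, (1 + -p n))) := by
    have := (ENNReal.continuous_ofReal.tendsto _).comp hmul.hasProd
    refine this.congr fun s => ?_
    rw [Function.comp_apply, ENNReal.ofReal_prod_of_nonneg fun n _ => by linarith [hp1 n]]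
    exact Finset.prod_congr rfl fun n _ => by simp only [hq, sub_eq_add_neg]
  rw [hprod.tprod_eq, ENNReal.ofReal_pos]
  refine lt_of_le_of_ne (ge_of_tendsto' hmul.hasProd fun s =>
    Finset.prod_nonneg fun n _ => by linarith [hp1 n]) (Ne.symm ?_)
  exact tprod_one_add_ne_zero_of_summable (fun n => by linarith [hp1 n]) hps.neg.norm

/-! ### Faber–Schauder functions -/

/-- The growth rate `2 ^ (1 / 4)`: the box constraints on the coefficients of level `j` widen like
`quarterRoot ^ j`, and the functions of level `j` have size of order `quarterRoot ^ (-2 j)`. -/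
def quarterRoot : ℝ := 2 ^ (1 / 4 : ℝ)

theorem quarterRoot_pow_four : quarterRoot ^ 4 = 2 := by
  rw [quarterRoot, ← Real.rpow_natCast, ← Real.rpow_mul (by norm_num)]; norm_num

theorem one_lt_quarterRoot : 1 < quarterRoot := Real.one_lt_rpow (by norm_num) (by norm_num)

theorem quarterRoot_pos : 0 < quarterRoot := one_pos.trans one_lt_quarterRoot

theorem quarterRoot_inv_pos : 0 < quarterRoot⁻¹ := inv_pos.2 quarterRoot_pos

theorem quarterRoot_inv_lt_one : quarterRoot⁻¹ < 1 := inv_lt_one_of_one_lt₀ one_lt_quarterRoot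

/-- The dyadic point `i / 2 ^ j`. -/
def dyadic (j i : ℕ) : ℝ := i / 2 ^ j

/-- The piecewise linear function vanishing outside `[k / 2 ^ j, (k + 1) / 2 ^ j]`, with slope `1`
on the left half of this interval and `-1` on the right half. -/
def tent (j k : ℕ) (θ : ℝ) : ℝ :=
  max (θ - dyadic (j + 1) (2 * k)) 0 - 2 * max (θ - dyadic (j + 1) (2 * k + 1)) 0 +
    max (θ - dyadic (j + 1) (2 * k + 2)) 0

/-- The Faber–Schauder functions on `[0, 1]`: the primitives of the `L²`-normalized Haar functions.
The function of index `0` is `θ`; for `2 ^ j ≤ n < 2 ^ (j + 1)`, the function of index `n` is the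
tent over the dyadic interval number `n - 2 ^ j` of length `2 ^ (-j)`, with slopes `± 2 ^ (j / 2)`.
The function of index `0` is written as a ramp so that all of them are combinations of ramps. -/
def schauder (n : ℕ) (θ : ℝ) : ℝ :=
  if n = 0 then max (θ - 0) 0
  else quarterRoot ^ (2 * Nat.log 2 n) * tent (Nat.log 2 n) (n - 2 ^ Nat.log 2 n) θ

theorem continuous_tent (j k : ℕ) : Continuous (tent j k) := by unfold tent; fun_prop

theorem continuous_schauder (n : ℕ) : Continuous (schauder n) := by
  unfold schauder
  split_ifs
  · fun_prop
  · exact continuous_const.mul (continuous_tent _ _)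

theorem schauder_level {j k : ℕ} (hk : k < 2 ^ j) (θ : ℝ) :
    schauder (2 ^ j + k) θ = quarterRoot ^ (2 * j) * tent j k θ := by
  have hlog : Nat.log 2 (2 ^ j + k) = j :=
    (Nat.log_eq_iff (Or.inr ⟨by norm_num, by positivity⟩)).2 ⟨by omega, by rw [pow_succ]; omega⟩
  have h0 : 2 ^ j + k ≠ 0 := by positivity
  rw [schauder, if_neg h0, hlog, Nat.add_sub_cancel_left]

theorem dyadic_tent_points (j k : ℕ) :
    dyadic (j + 1) (2 * k) = k / 2 ^ j ∧
    dyadic (j + 1) (2 * k + 1) = k / 2 ^ j + 1 / 2 ^ (j + 1) ∧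
    dyadic (j + 1) (2 * k + 2) = k / 2 ^ j + 2 * (1 / 2 ^ (j + 1)) := by
  unfold dyadic
  have : (2 : ℝ) ^ j ≠ 0 := by positivity
  refine ⟨?_, ?_, ?_⟩ <;> push_cast <;> field_simp <;> ring

theorem tent_nonneg (j k : ℕ) (θ : ℝ) : 0 ≤ tent j k θ := by
  obtain ⟨h1, h2, h3⟩ := dyadic_tent_points j k
  have hd : (0 : ℝ) < 1 / 2 ^ (j + 1) := by positivity
  rw [tent, h1, h2, h3]
  rcases max_cases (θ - k / 2 ^ j) 0 with h | h <;>
  rcases max_cases (θ - (k / 2 ^ j + 1 / 2 ^ (j + 1))) 0 with h' | h' <;>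
  rcases max_cases (θ - (k / 2 ^ j + 2 * (1 / 2 ^ (j + 1)))) 0 with h'' | h'' <;> linarith

theorem tent_le (j k : ℕ) (θ : ℝ) : tent j k θ ≤ 1 / 2 ^ (j + 1) := by
  obtain ⟨h1, h2, h3⟩ := dyadic_tent_points j k
  have hd : (0 : ℝ) < 1 / 2 ^ (j + 1) := by positivity
  rw [tent, h1, h2, h3]
  rcases max_cases (θ - k / 2 ^ j) 0 with h | h <;>
  rcases max_cases (θ - (k / 2 ^ j + 1 / 2 ^ (j + 1))) 0 with h' | h' <;>
  rcases max_cases (θ - (k / 2 ^ j + 2 * (1 / 2 ^ (j + 1)))) 0 with h'' | h'' <;> linarith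

/-- A tent which does not vanish at `θ ≥ 0` lies over the dyadic interval containing `θ`. -/
theorem tent_eq_zero {j k : ℕ} {θ : ℝ} (hθ : 0 ≤ θ) (hk : k ≠ ⌊2 ^ j * θ⌋₊) :
    tent j k θ = 0 := by
  obtain ⟨h1, h2, h3⟩ := dyadic_tent_points j k
  have hp : (0 : ℝ) < 2 ^ j := by positivity
  have hd : (0 : ℝ) < 1 / 2 ^ (j + 1) := by positivity
  have hd2 : (2 : ℝ) * (1 / 2 ^ (j + 1)) = 1 / 2 ^ j := by rw [pow_succ]; field_simp
  rw [tent, h1, h2, h3]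
  have hx : 0 ≤ 2 ^ j * θ := by positivity
  rcases lt_or_gt_of_ne hk with h | h
  · have h4 : ((k : ℝ) + 1) ≤ 2 ^ j * θ := by
      have := Nat.floor_le hx
      have h5 : (k : ℝ) + 1 ≤ ⌊2 ^ j * θ⌋₊ := by exact_mod_cast h
      linarith
    have h6 : (k : ℝ) / 2 ^ j + 2 * (1 / 2 ^ (j + 1)) ≤ θ := by
      rw [hd2, ← add_div, div_le_iff₀ hp]; linarith
    rw [max_eq_left (by linarith), max_eq_left (by linarith), max_eq_left (by linarith)]
    ring
  · have h4 : 2 ^ j * θ < k := (Nat.floor_lt hx).1 h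
    have h6 : θ ≤ (k : ℝ) / 2 ^ j := by rw [le_div_iff₀ hp]; linarith
    rw [max_eq_right (by linarith), max_eq_right (by linarith), max_eq_right (by linarith)]
    ring

theorem sum_range_two_pow_succ {M : Type*} [AddCommMonoid M] (g : ℕ → M) (j : ℕ) :
    ∑ n ∈ Finset.range (2 ^ (j + 1)), g n =
      ∑ n ∈ Finset.range (2 ^ j), g n + ∑ k ∈ Finset.range (2 ^ j), g (2 ^ j + k) := by
  rw [pow_succ, mul_two, Finset.sum_range_add]

/-- The bound imposed on the absolute value of the coefficient of index `n`: it is `ε 2 ^ (j / 4)`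
at level `j`, and `ε` for `n = 0`, as `Nat.log 2 0 = 0`. -/
def boxWidth (ε : ℝ) (n : ℕ) : ℝ := ε * quarterRoot ^ Nat.log 2 n

theorem boxWidth_pos {ε : ℝ} (hε : 0 < ε) (n : ℕ) : 0 < boxWidth ε n :=
  mul_pos hε (pow_pos quarterRoot_pos _)

/-- The box constraints have summable failure probabilities, since Gaussian eighth moments are
finite and the eighth power of the constraint of index `n` is of order `n²`. -/
theorem tsum_boxWidth_ne_top {ε : ℝ} (hε : 0 < ε) :
    ∑' n, gaussianReal 0 1 {x : ℝ | boxWidth ε n < |x|} ≠ ∞ := by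
  obtain ⟨M, hM0, hM⟩ := exists_gaussianReal_abs_gt_le
  have hs : Summable fun n : ℕ => 4 * M / ε ^ 8 * (1 / ((n : ℝ) + 1) ^ 2) := by
    have := (summable_nat_add_iff 1).2 (Real.summable_one_div_nat_pow.2 one_lt_two)
    push_cast at this
    exact this.mul_left _
  refine ne_top_of_le_ne_top hs.tsum_ofReal_ne_top (ENNReal.tsum_le_tsum fun n => ?_)
  refine (hM _ (boxWidth_pos hε n)).trans (ENNReal.ofReal_le_ofReal ?_)
  -- `boxWidth ε n ^ 8 = ε ^ 8 * 4 ^ j` with `n + 1 ≤ 2 ^ (j + 1)`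
  have h1 : ((n : ℝ) + 1) ≤ 2 * 2 ^ Nat.log 2 n := by
    have := Nat.lt_pow_succ_log_self (b := 2) (by norm_num) n
    rw [pow_succ] at this
    exact_mod_cast (by omega : n + 1 ≤ 2 * 2 ^ Nat.log 2 n)
  have h2 : boxWidth ε n ^ 8 = ε ^ 8 * (2 ^ Nat.log 2 n) ^ 2 := by
    rw [← quarterRoot_pow_four, boxWidth]
    ring
  have h3 : ((n : ℝ) + 1) ^ 2 ≤ 4 * (2 ^ Nat.log 2 n) ^ 2 := by
    nlinarith [pow_le_pow_left₀ (by positivity) h1 2]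
  rw [h2, div_mul_div_comm, div_le_div_iff₀ (by positivity) (by positivity)]
  have : 0 ≤ M * ε ^ 8 := by positivity
  nlinarith [mul_le_mul_of_nonneg_left h3 this]

/-- At most one Schauder function of each level is nonzero at a given point, so that the sum over a
level is controlled by the largest coefficient. -/
theorem abs_sum_schauder_level_le {ε θ : ℝ} (hθ : 0 ≤ θ) {j : ℕ} {x : ℕ → ℝ}
    (hx : ∀ k < 2 ^ j, |x (2 ^ j + k)| ≤ boxWidth ε (2 ^ j + k)) :
    |∑ k ∈ Finset.range (2 ^ j), x (2 ^ j + k) * schauder (2 ^ j + k) θ| ≤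
      ε * quarterRoot⁻¹ ^ j := by
  have hε : 0 ≤ ε := by
    have := (abs_nonneg _).trans (hx 0 (by positivity))
    exact nonneg_of_mul_nonneg_left this (pow_pos quarterRoot_pos _)
  have hrhs : 0 ≤ ε * quarterRoot⁻¹ ^ j := mul_nonneg hε (pow_nonneg quarterRoot_inv_pos.le _)
  set k₀ := ⌊2 ^ j * θ⌋₊ with hk₀
  have hz : ∀ k ∈ Finset.range (2 ^ j), k ≠ k₀ →
      x (2 ^ j + k) * schauder (2 ^ j + k) θ = 0 := by
    intro k hk hne
    rw [schauder_level (Finset.mem_range.1 hk), tent_eq_zero hθ hne]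
    ring
  by_cases hmem : k₀ ∈ Finset.range (2 ^ j)
  · rw [Finset.sum_eq_single_of_mem k₀ hmem hz, abs_mul,
      schauder_level (Finset.mem_range.1 hmem), abs_of_nonneg (a := _ * tent j k₀ θ)
        (mul_nonneg (pow_nonneg quarterRoot_pos.le _) (tent_nonneg _ _ _))]
    have h1 := hx k₀ (Finset.mem_range.1 hmem)
    have hlog : Nat.log 2 (2 ^ j + k₀) = j := by
      have := Finset.mem_range.1 hmem
      exact (Nat.log_eq_iff (Or.inr ⟨by norm_num, by positivity⟩)).2
        ⟨by omega, by rw [pow_succ]; omega⟩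
    rw [boxWidth, hlog] at h1
    have h2 : tent j k₀ θ ≤ (quarterRoot ^ (4 * j))⁻¹ := by
      refine (tent_le j k₀ θ).trans ?_
      rw [pow_mul, quarterRoot_pow_four, one_div]
      gcongr
      · norm_num
      · omega
    have hq := quarterRoot_pos
    calc |x (2 ^ j + k₀)| * (quarterRoot ^ (2 * j) * tent j k₀ θ)
        ≤ (ε * quarterRoot ^ j) * (quarterRoot ^ (2 * j) * (quarterRoot ^ (4 * j))⁻¹) := by
          gcongr
          exact mul_nonneg (pow_nonneg quarterRoot_pos.le _) (tent_nonneg _ _ _)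
      _ = ε * quarterRoot⁻¹ ^ j := by
          rw [inv_pow]; field_simp; ring
  · rw [Finset.sum_eq_zero fun k hk => hz k hk fun h => hmem (h ▸ hk)]
    simpa using hrhs

theorem abs_sum_schauder_le {ε θ : ℝ} (hθ : θ ∈ Icc (0 : ℝ) 1) {x : ℕ → ℝ}
    (hx : ∀ n, |x n| ≤ boxWidth ε n) (J : ℕ) :
    |∑ n ∈ Finset.range (2 ^ J), x n * schauder n θ| ≤
      ε * (1 + (1 - quarterRoot⁻¹)⁻¹) := by
  have hε : 0 ≤ ε := by
    have := (abs_nonneg _).trans (hx 0)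
    exact nonneg_of_mul_nonneg_left this (pow_pos quarterRoot_pos _)
  have key : |∑ n ∈ Finset.range (2 ^ J), x n * schauder n θ| ≤
      ε * (1 + ∑ j ∈ Finset.range J, quarterRoot⁻¹ ^ j) := by
    induction J with
    | zero =>
      have h0 := hx 0
      simp only [boxWidth, Nat.log_zero_right, pow_zero, mul_one] at h0
      simp only [pow_zero, Finset.range_one, Finset.sum_singleton, Finset.range_zero,
        Finset.sum_empty, add_zero, schauder, if_true, sub_zero, mul_one, abs_mul]
      rw [max_eq_left hθ.1, abs_of_nonneg hθ.1]
      nlinarith [abs_nonneg (x 0), hθ.1, hθ.2]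
    | succ J ih =>
      rw [sum_range_two_pow_succ, Finset.sum_range_succ]
      have := abs_sum_schauder_level_le hθ.1 (j := J) (x := x) (ε := ε) fun k _ => hx _
      refine (abs_add_le _ _).trans ?_
      nlinarith
  refine key.trans ?_
  gcongr
  rw [← tsum_geometric_of_lt_one quarterRoot_inv_pos.le quarterRoot_inv_lt_one]
  exact (summable_geometric_of_lt_one quarterRoot_inv_pos.le quarterRoot_inv_lt_one).sum_le_tsum _
    fun i _ => pow_nonneg quarterRoot_inv_pos.le _

/-! ### The covariance form of `(-A)⁻¹` -/

theorem integral_leb_eq (f : ℝ → ℝ) : ∫ θ, f θ ∂leb = ∫ θ in (0 : ℝ)..1, f θ := by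
  rw [intervalIntegral.integral_of_le zero_le_one, integral_Ioc_eq_integral_Ioo]

theorem memLp_leb_of_continuous {f : ℝ → ℝ} (hf : Continuous f) : MemLp f 2 leb := by
  obtain ⟨C, hC⟩ := (isCompact_Icc (a := (0 : ℝ)) (b := 1)).exists_bound_of_continuousOn
    hf.continuousOn
  refine MemLp.of_bound hf.aestronglyMeasurable C ?_
  filter_upwards [ae_restrict_mem measurableSet_Ioo] with s hs
  exact hC s (Ioo_subset_Icc_self hs)

theorem constL2_ae (a : ℝ) : ∀ᵐ s ∂leb, constL2 a s = a := by
  filter_upwards [Lp.coeFn_const (p := 2) (μ := leb) a] with s hs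
  simpa [constL2] using hs

theorem mean_add (h k : L2) : mean (h + k) = mean h + mean k := by
  rw [mean, mean, mean, ← integral_add (integrable_L2 h) (integrable_L2 k)]
  exact integral_congr_ae (Lp.coeFn_add h k)

theorem mean_smul (a : ℝ) (h : L2) : mean (a • h) = a * mean h := by
  rw [mean, mean, ← integral_const_mul]
  refine integral_congr_ae ?_
  filter_upwards [Lp.coeFn_smul a h] with s hs
  simp [hs]

/-- The function `h - mean h` on `(0, 1)`, extended by zero to the line. -/
def centered (h : L2) : ℝ → ℝ := (Ioo (0 : ℝ) 1).indicator fun s => h s - mean h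

theorem integrable_centered (h : L2) : Integrable (centered h) :=
  (integrable_indicator_iff measurableSet_Ioo).2 ((integrable_L2 h).sub (integrable_const _))

theorem centered_ae (h : L2) : ∀ᵐ s ∂leb, centered h s = h s - mean h := by
  filter_upwards [ae_restrict_mem measurableSet_Ioo] with s hs
  simp [centered, hs]

theorem integral_centered (h : L2) : ∫ s in (0 : ℝ)..1, centered h s = 0 := by
  rw [← integral_leb_eq, integral_congr_ae (centered_ae h),
    integral_sub (integrable_L2 h) (integrable_const _)]
  simp [mean, Measure.real]

theorem centered_add (h k : L2) :
    centered (h + k) =ᵐ[volume] fun s => centered h s + centered k s := by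
  have := (ae_restrict_iff' measurableSet_Ioo).1 (Lp.coeFn_add h k)
  filter_upwards [this] with s hs
  by_cases hm : s ∈ Ioo (0 : ℝ) 1
  · simp only [centered, indicator_of_mem hm, hs hm, mean_add, Pi.add_apply]; ring
  · simp [centered, indicator_of_notMem hm]

theorem centered_smul (a : ℝ) (h : L2) :
    centered (a • h) =ᵐ[volume] fun s => a * centered h s := by
  have := (ae_restrict_iff' measurableSet_Ioo).1 (Lp.coeFn_smul a h)
  filter_upwards [this] with s hs
  by_cases hm : s ∈ Ioo (0 : ℝ) 1
  · simp only [centered, indicator_of_mem hm, hs hm, mean_smul, Pi.smul_apply, smul_eq_mul]; ring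
  · simp [centered, indicator_of_notMem hm]

/-- The derivative of `(-A)⁻¹ h`: the primitive of `mean h - h` vanishing at `0` and `1`. -/
def flux (h : L2) (s : ℝ) : ℝ := -∫ τ in (0 : ℝ)..s, centered h τ

theorem continuous_flux (h : L2) : Continuous (flux h) :=
  (intervalIntegral.continuous_primitive
    (fun _ _ => (integrable_centered h).intervalIntegrable) 0).neg

theorem flux_one (h : L2) : flux h 1 = 0 := by rw [flux, integral_centered, neg_zero]

theorem flux_add (h k : L2) (s : ℝ) : flux (h + k) s = flux h s + flux k s := by
  rw [flux, flux, flux, intervalIntegral.integral_congr_ae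
    (g := fun τ => centered h τ + centered k τ) ((centered_add h k).mono fun _ h _ => h),
    intervalIntegral.integral_add (integrable_centered h).intervalIntegrable
      (integrable_centered k).intervalIntegrable]
  ring

theorem flux_smul (a : ℝ) (h : L2) (s : ℝ) : flux (a • h) s = a * flux h s := by
  rw [flux, flux, intervalIntegral.integral_congr_ae
    (g := fun τ => a * centered h τ) ((centered_smul a h).mono fun _ h _ => h),
    intervalIntegral.integral_const_mul]
  ring

theorem inner_eq_integral_centered {u : L2} {f : ℝ → ℝ}
    (hu : ∀ᵐ θ ∂leb, u θ = f θ) (hmean : mean u = 0) (h : L2) :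
    ⟪u, h⟫ = ∫ θ in (0 : ℝ)..1, f θ * centered h θ := by
  have hi : Integrable (fun θ => ⟪u θ, h θ⟫) leb := L2.integrable_inner u h
  have h1 : ∫ θ, f θ * centered h θ ∂leb = ∫ θ, (⟪u θ, h θ⟫ - u θ * mean h) ∂leb := by
    refine integral_congr_ae ?_
    filter_upwards [hu, centered_ae h] with θ h1 h2
    rw [h2, ← h1]
    simp
    ring
  rw [← integral_leb_eq, h1, integral_sub hi ((integrable_L2 u).mul_const _), integral_mul_const]
  change _ = _ - mean u * _
  rw [hmean, zero_mul, sub_zero, L2.inner_def]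

/-- Integration by parts for primitives of integrable functions. -/
theorem integral_primitive_mul {f g : ℝ → ℝ} {a b : ℝ} (hf : IntervalIntegrable f volume a b)
    (hg : IntervalIntegrable g volume a b) :
    ∫ θ in a..b, (∫ s in a..θ, f s) * g θ =
      (∫ s in a..b, f s) * (∫ s in a..b, g s) - ∫ θ in a..b, f θ * ∫ s in a..θ, g s := by
  have key := AbsolutelyContinuousOnInterval.integral_mul_deriv_eq_deriv_mul
    (hf.absolutelyContinuousOnInterval_intervalIntegral left_mem_uIcc)
    (hg.absolutelyContinuousOnInterval_intervalIntegral left_mem_uIcc)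
  simp only [intervalIntegral.integral_same, mul_zero, sub_zero] at key
  have e1 : ∫ θ in a..b, (∫ s in a..θ, f s) * deriv (fun x => ∫ s in a..x, g s) θ =
      ∫ θ in a..b, (∫ s in a..θ, f s) * g θ := by
    refine intervalIntegral.integral_congr_ae ?_
    filter_upwards [hg.ae_hasDerivAt_integral] with θ hθ hm
    rw [(hθ (uIoc_subset_uIcc hm) a left_mem_uIcc).deriv]
  have e2 : ∫ θ in a..b, deriv (fun x => ∫ s in a..x, f s) θ * (∫ s in a..θ, g s) =
      ∫ θ in a..b, f θ * ∫ s in a..θ, g s := by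
    refine intervalIntegral.integral_congr_ae ?_
    filter_upwards [hf.ae_hasDerivAt_integral] with θ hθ hm
    rw [(hθ (uIoc_subset_uIcc hm) a left_mem_uIcc).deriv]
  rw [← e1, key, e2]

/-- The covariance form of `N(0, (-A)⁻¹)`. -/
theorem inner_negLapInv (h k : L2) :
    ⟪negLapInv h, k⟫ = ∫ s in (0 : ℝ)..1, flux h s * flux k s := by
  obtain ⟨⟨U, V, hu, hU, hV, hV0, hV1⟩, hmean⟩ := negLapInv_spec h
  have hVf : ∀ θ ∈ Icc (0 : ℝ) 1, V θ = flux h θ := by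
    intro θ hθ
    rw [hV θ hθ, hV0, zero_add, flux, ← intervalIntegral.integral_neg]
    refine intervalIntegral_congr_leb ?_ hθ
    filter_upwards [Lp.coeFn_neg (h - constL2 (mean h)), Lp.coeFn_sub h (constL2 (mean h)),
      constL2_ae (mean h), centered_ae h] with s h1 h2 h3 h4
    rw [h1, Pi.neg_apply, h2, Pi.sub_apply, h3, h4]
  have hUf : ∀ θ ∈ Icc (0 : ℝ) 1, U θ = U 0 + ∫ s in (0 : ℝ)..θ, flux h s := by
    intro θ hθ
    rw [hU θ hθ]
    congr 1
    refine intervalIntegral.integral_congr fun s hs => ?_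
    rw [uIcc_of_le hθ.1] at hs
    exact hVf s ⟨hs.1, hs.2.trans hθ.2⟩
  have hfi : ∀ a b, IntervalIntegrable (flux h) volume a b := fun a b =>
    (continuous_flux h).intervalIntegrable a b
  have hci : ∀ a b, IntervalIntegrable (centered k) volume a b := fun a b =>
    (integrable_centered k).intervalIntegrable
  have hcont : Continuous fun θ => ∫ s in (0 : ℝ)..θ, flux h s :=
    intervalIntegral.continuous_primitive hfi 0
  have hue : ∀ᵐ θ ∂leb, negLapInv h θ = U 0 + ∫ s in (0 : ℝ)..θ, flux h s := by
    filter_upwards [hu, ae_restrict_mem measurableSet_Ioo] with s hs hs'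
    rw [hs, hUf s (Ioo_subset_Icc_self hs')]
  -- The constant `U 0` and the boundary terms drop out because `centered k` has integral zero.
  rw [inner_eq_integral_centered hue hmean]
  simp_rw [add_mul]
  rw [intervalIntegral.integral_add ((hci 0 1).const_mul _)
    ((hci 0 1).continuousOn_mul hcont.continuousOn), intervalIntegral.integral_const_mul,
    integral_centered, integral_primitive_mul (hfi 0 1) (hci 0 1), integral_centered]
  simp [flux]

/-- The class in `L²(0,1)` of a continuous function minus its average. -/
def centeredL2 (f : ℝ → ℝ) (hf : Continuous f) : L2 :=
  (memLp_leb_of_continuous (hf.sub continuous_const) :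
    MemLp (fun θ => f θ - ∫ s in (0 : ℝ)..1, f s) 2 leb).toLp _

theorem centeredL2_ae {f : ℝ → ℝ} (hf : Continuous f) :
    ∀ᵐ θ ∂leb, centeredL2 f hf θ = f θ - ∫ s in (0 : ℝ)..1, f s :=
  MemLp.coeFn_toLp _

theorem inner_centeredL2 {f : ℝ → ℝ} (hf : Continuous f) (h : L2) :
    ⟪centeredL2 f hf, h⟫ = ∫ θ in (0 : ℝ)..1, f θ * centered h θ := by
  have hmean : mean (centeredL2 f hf) = 0 := by
    rw [mean, integral_congr_ae (centeredL2_ae hf), integral_leb_eq,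
      intervalIntegral.integral_sub (hf.intervalIntegrable _ _) (by simp)]
    simp
  have hci : IntervalIntegrable (centered h) volume 0 1 :=
    (integrable_centered h).intervalIntegrable
  rw [inner_eq_integral_centered (centeredL2_ae hf) hmean]
  simp_rw [sub_mul]
  rw [intervalIntegral.integral_sub (hci.continuousOn_mul hf.continuousOn) (hci.const_mul _),
    intervalIntegral.integral_const_mul, integral_centered, mul_zero, sub_zero]

theorem integral_ramp_mul_centered (h : L2) {a : ℝ} (ha : a ∈ Icc (0 : ℝ) 1) :
    ∫ θ in (0 : ℝ)..1, max (θ - a) 0 * centered h θ = ∫ s in a..1, flux h s := by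
  have hci : ∀ a b, IntervalIntegrable (centered h) volume a b := fun a b =>
    (integrable_centered h).intervalIntegrable
  have hc : Continuous fun θ : ℝ => max (θ - a) 0 := by fun_prop
  have hfi : IntervalIntegrable (flux h) volume a 1 :=
    (continuous_flux h).intervalIntegrable a 1
  rw [← intervalIntegral.integral_add_adjacent_intervals
    ((hci 0 a).continuousOn_mul hc.continuousOn) ((hci a 1).continuousOn_mul hc.continuousOn)]
  have e1 : ∫ θ in (0 : ℝ)..a, max (θ - a) 0 * centered h θ = 0 := by
    rw [intervalIntegral.integral_congr (g := fun _ => 0), intervalIntegral.integral_zero]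
    intro θ hθ
    rw [uIcc_of_le ha.1] at hθ
    simp [max_eq_right (sub_nonpos.2 hθ.2)]
  have e2 : ∫ θ in a..1, max (θ - a) 0 * centered h θ =
      ∫ θ in a..1, (∫ _ in a..θ, (1 : ℝ)) * centered h θ := by
    refine intervalIntegral.integral_congr fun θ hθ => ?_
    rw [uIcc_of_le ha.2] at hθ
    simp [max_eq_left (sub_nonneg.2 hθ.1)]
  have e3 : ∀ θ, ∫ s in a..θ, centered h s = flux h a - flux h θ := by
    intro θ
    rw [flux, flux, ← intervalIntegral.integral_interval_sub_left (hci 0 θ) (hci 0 a)]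
    ring
  rw [e1, e2, integral_primitive_mul (by simp) (hci a 1), e3, flux_one]
  simp_rw [e3, one_mul]
  rw [intervalIntegral.integral_sub (by simp) hfi]
  simp

/-! ### Parseval's identity for the Haar system -/

/-- The centred Faber–Schauder functions in `L²(0,1)`. -/
def schauderL2 (n : ℕ) : L2 := centeredL2 (schauder n) (continuous_schauder n)

/-- The integral of `V` over the dyadic interval number `k` of length `2 ^ (-j)`. -/
def dyadicIntegral (V : ℝ → ℝ) (j k : ℕ) : ℝ := ∫ s in dyadic j k..dyadic j (k + 1), V s

theorem dyadic_mem {j i : ℕ} (hi : i ≤ 2 ^ j) : dyadic j i ∈ Icc (0 : ℝ) 1 := by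
  refine ⟨by unfold dyadic; positivity, ?_⟩
  rw [dyadic, div_le_one (by positivity)]
  exact_mod_cast hi

theorem dyadic_succ (j k : ℕ) : dyadic (j + 1) (2 * k) = dyadic j k := by
  rw [(dyadic_tent_points j k).1, dyadic]

theorem dyadicIntegral_split {V : ℝ → ℝ} (hV : Continuous V) (j k : ℕ) :
    dyadicIntegral V j k =
      dyadicIntegral V (j + 1) (2 * k) + dyadicIntegral V (j + 1) (2 * k + 1) := by
  unfold dyadicIntegral
  rw [intervalIntegral.integral_add_adjacent_intervals (hV.intervalIntegrable _ _)
    (hV.intervalIntegrable _ _), dyadic_succ, show 2 * k + 1 + 1 = 2 * (k + 1) by ring,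
    dyadic_succ]

theorem inner_schauderL2_zero (h : L2) :
    ⟪schauderL2 0, h⟫ = ∫ s in (0 : ℝ)..1, flux h s := by
  rw [schauderL2, inner_centeredL2]
  simp only [schauder, if_true]
  exact integral_ramp_mul_centered h (by simp)

/-- Up to normalization, `⟪schauderL2 n, h⟫` is the Haar coefficient of `flux h`. -/
theorem inner_schauderL2_level (h : L2) {j k : ℕ} (hk : k < 2 ^ j) :
    ⟪schauderL2 (2 ^ j + k), h⟫ = quarterRoot ^ (2 * j) *
      (dyadicIntegral (flux h) (j + 1) (2 * k) - dyadicIntegral (flux h) (j + 1) (2 * k + 1)) := by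
  have hci : IntervalIntegrable (centered h) volume 0 1 :=
    (integrable_centered h).intervalIntegrable
  have hfi : ∀ a b, IntervalIntegrable (flux h) volume a b := fun a b =>
    (continuous_flux h).intervalIntegrable a b
  have hr : ∀ a, IntervalIntegrable (fun θ => max (θ - a) 0 * centered h θ) volume 0 1 := by
    intro a
    have hc : Continuous fun θ : ℝ => max (θ - a) 0 := by fun_prop
    exact hci.continuousOn_mul hc.continuousOn
  rw [schauderL2, inner_centeredL2]
  simp_rw [schauder_level hk, mul_assoc]
  rw [intervalIntegral.integral_const_mul]
  congr 1
  simp_rw [tent, add_mul, sub_mul, mul_assoc]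
  have hpow : 2 ^ (j + 1) = 2 * 2 ^ j := by ring
  rw [intervalIntegral.integral_add ((hr _).sub ((hr _).const_mul 2)) (hr _),
    intervalIntegral.integral_sub (hr _) ((hr _).const_mul 2),
    intervalIntegral.integral_const_mul,
    integral_ramp_mul_centered h (dyadic_mem (by omega)),
    integral_ramp_mul_centered h (dyadic_mem (by omega)),
    integral_ramp_mul_centered h (dyadic_mem (by omega))]
  unfold dyadicIntegral
  have e := fun a b c => intervalIntegral.integral_add_adjacent_intervals
    (hfi a b) (hfi b c)
  rw [← e (dyadic (j + 1) (2 * k)) (dyadic (j + 1) (2 * k + 1)) 1,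
    ← e (dyadic (j + 1) (2 * k + 1)) (dyadic (j + 1) (2 * k + 1 + 1)) 1]
  ring

/-- The split of the dyadic intervals of one level into those of the next. -/
theorem sum_range_two_mul (g : ℕ → ℝ) (m : ℕ) :
    ∑ n ∈ Finset.range (2 * m), g n = ∑ k ∈ Finset.range m, (g (2 * k) + g (2 * k + 1)) := by
  induction m with
  | zero => simp
  | succ m ih => rw [Finset.sum_range_succ, ← ih, mul_add, mul_one, Finset.sum_range_succ,
      Finset.sum_range_succ, add_assoc]

/-- The squared norm of the projection of `flux h` to the functions that are constant on the dyadic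
intervals of length `2 ^ (-J)`. -/
theorem sum_inner_schauderL2_sq (h : L2) (J : ℕ) :
    ∑ n ∈ Finset.range (2 ^ J), ⟪schauderL2 n, h⟫ ^ 2 =
      ∑ k ∈ Finset.range (2 ^ J), 2 ^ J * dyadicIntegral (flux h) J k ^ 2 := by
  induction J with
  | zero => simp [inner_schauderL2_zero, dyadicIntegral, dyadic]
  | succ J ih =>
    rw [sum_range_two_pow_succ, ih, pow_succ' 2 J, sum_range_two_mul, ← Finset.sum_add_distrib]
    refine Finset.sum_congr rfl fun k hk => ?_
    have hq : (quarterRoot ^ (2 * J)) ^ 2 = 2 ^ J := by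
      rw [← quarterRoot_pow_four]; ring
    rw [inner_schauderL2_level h (Finset.mem_range.1 hk),
      dyadicIntegral_split (continuous_flux h) J k, mul_pow, hq]
    ring

theorem abs_integral_sq_sub_le {V : ℝ → ℝ} (hV : Continuous V) {l d ε : ℝ} (hd : 0 < d)
    (hosc : ∀ s ∈ Icc l (l + d), |V s - V l| ≤ ε) :
    |(∫ s in l..l + d, V s ^ 2) - (∫ s in l..l + d, V s) ^ 2 / d| ≤ ε ^ 2 * d := by
  have hε : 0 ≤ ε := (abs_nonneg _).trans (hosc l ⟨le_rfl, by linarith⟩)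
  -- Subtracting a constant from `V` does not change the left-hand side.
  set c := V l with hc
  set A := ∫ s in l..l + d, (V s - c) with hA
  set B := ∫ s in l..l + d, (V s - c) ^ 2 with hB
  have hle : l ≤ l + d := by linarith
  have hmem : ∀ s ∈ uIoc l (l + d), s ∈ Icc l (l + d) := fun s hs => by
    rw [uIoc_of_le hle] at hs; exact Ioc_subset_Icc_self hs
  have hA' : |A| ≤ ε * d := by
    have := intervalIntegral.norm_integral_le_of_norm_le_const (a := l) (b := l + d)
      (f := fun s => V s - c) (C := ε) fun s hs => hosc s (hmem s hs)
    simpa [abs_of_pos hd] using this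
  have hB' : B ≤ ε ^ 2 * d := by
    have := intervalIntegral.norm_integral_le_of_norm_le_const (a := l) (b := l + d)
      (f := fun s => (V s - c) ^ 2) (C := ε ^ 2) fun s hs => by
        rw [Real.norm_eq_abs, abs_pow]
        exact pow_le_pow_left₀ (abs_nonneg _) (hosc s (hmem s hs)) 2
    rw [add_sub_cancel_left, abs_of_pos hd] at this
    exact (le_abs_self _).trans this
  have hB0 : 0 ≤ B := intervalIntegral.integral_nonneg hle fun s _ => sq_nonneg _
  have e1 : ∫ s in l..l + d, V s = A + c * d := by
    rw [hA, intervalIntegral.integral_sub (hV.intervalIntegrable _ _) (by simp)]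
    simp; ring
  have e2 : ∫ s in l..l + d, V s ^ 2 = B + 2 * c * A + c ^ 2 * d := by
    have : ∀ s, V s ^ 2 = (V s - c) ^ 2 + 2 * c * (V s - c) + c ^ 2 := fun s => by ring
    simp_rw [this]
    rw [intervalIntegral.integral_add, intervalIntegral.integral_add,
      intervalIntegral.integral_const_mul]
    · simp; ring
    all_goals exact Continuous.intervalIntegrable (by fun_prop) _ _
  have e3 : (∫ s in l..l + d, V s ^ 2) - (∫ s in l..l + d, V s) ^ 2 / d = B - A ^ 2 / d := by
    rw [e1, e2]; field_simp; ring
  have hA2 : A ^ 2 / d ≤ ε ^ 2 * d := by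
    rw [div_le_iff₀ hd]
    nlinarith [sq_abs A, abs_nonneg A, mul_self_le_mul_self (abs_nonneg A) hA']
  have hA0 : 0 ≤ A ^ 2 / d := by positivity
  rw [e3, abs_le]
  constructor <;> linarith

theorem dyadic_add_one (j k : ℕ) : dyadic j (k + 1) = dyadic j k + 1 / 2 ^ j := by
  unfold dyadic; push_cast; ring

/-- The projections of a continuous function to dyadic step functions converge in norm. -/
theorem tendsto_sum_dyadicIntegral_sq {V : ℝ → ℝ} (hV : Continuous V) :
    Tendsto (fun J => ∑ k ∈ Finset.range (2 ^ J), 2 ^ J * dyadicIntegral V J k ^ 2) atTop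
      (𝓝 (∫ s in (0 : ℝ)..1, V s ^ 2)) := by
  rw [Metric.tendsto_atTop]
  intro η hη
  set ε := Real.sqrt (η / 2) with hε
  have hε2 : ε ^ 2 = η / 2 := Real.sq_sqrt (by positivity)
  have hεpos : 0 < ε := Real.sqrt_pos.2 (by positivity)
  have huc := (isCompact_Icc (a := (0 : ℝ)) (b := 1)).uniformContinuousOn_of_continuous
    hV.continuousOn
  rw [Metric.uniformContinuousOn_iff] at huc
  obtain ⟨δ, hδ, hosc⟩ := huc ε hεpos
  obtain ⟨N, hN⟩ := exists_pow_lt_of_lt_one hδ (by norm_num : (1 / 2 : ℝ) < 1)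
  refine ⟨N, fun J hJ => ?_⟩
  set d : ℝ := 1 / 2 ^ J with hd
  have hd0 : 0 < d := by positivity
  have hdδ : d < δ := by
    refine lt_of_le_of_lt ?_ hN
    rw [hd, ← one_div_pow]
    exact pow_le_pow_of_le_one (by norm_num) (by norm_num) hJ
  have hsum : ∫ s in (0 : ℝ)..1, V s ^ 2 =
      ∑ k ∈ Finset.range (2 ^ J), ∫ s in dyadic J k..dyadic J (k + 1), V s ^ 2 := by
    rw [intervalIntegral.sum_integral_adjacent_intervals
      (f := fun s => V s ^ 2) fun k _ => (hV.pow 2).intervalIntegrable _ _]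
    congr 1 <;> simp [dyadic]
  rw [hsum, Real.dist_eq, abs_sub_comm, ← Finset.sum_sub_distrib]
  have hk : ∀ k ∈ Finset.range (2 ^ J), |(∫ s in dyadic J k..dyadic J (k + 1), V s ^ 2) -
      2 ^ J * dyadicIntegral V J k ^ 2| ≤ ε ^ 2 * d := by
    intro k hk
    have hk' := Finset.mem_range.1 hk
    have h0 := dyadic_mem (j := J) (i := k) (by omega)
    have h1 := dyadic_mem (j := J) (i := k + 1) (by omega)
    rw [dyadic_add_one] at h1
    have := abs_integral_sq_sub_le hV (l := dyadic J k) (ε := ε) hd0 fun s hs => by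
      refine (hosc s ⟨h0.1.trans hs.1, hs.2.trans h1.2⟩ _ h0 ?_).le
      rw [Real.dist_eq, abs_of_nonneg (by linarith [hs.1])]
      linarith [hs.2]
    rw [dyadicIntegral, dyadic_add_one]
    convert this using 3
    rw [hd]; field_simp
  calc _ ≤ ∑ k ∈ Finset.range (2 ^ J), ε ^ 2 * d :=
        (Finset.abs_sum_le_sum_abs _ _).trans (Finset.sum_le_sum hk)
    _ = η / 2 := by
        rw [Finset.sum_const, Finset.card_range, hε2, hd, nsmul_eq_mul]
        push_cast
        field_simp
    _ < η := by linarith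

theorem tendsto_sum_inner_schauderL2_sq (h : L2) :
    Tendsto (fun J => ∑ n ∈ Finset.range (2 ^ J), ⟪schauderL2 n, h⟫ ^ 2) atTop
      (𝓝 ⟪negLapInv h, h⟫) := by
  simp_rw [sum_inner_schauderL2_sq, inner_negLapInv, ← sq]
  exact tendsto_sum_dyadicIntegral_sq (continuous_flux h)

theorem inner_negLapInv_smul (a : ℝ) (h : L2) :
    ⟪negLapInv (a • h), a • h⟫ = a ^ 2 * ⟪negLapInv h, h⟫ := by
  simp_rw [inner_negLapInv, flux_smul, ← intervalIntegral.integral_const_mul]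
  congr 1
  ext s
  ring

theorem inner_negLapInv_add (h k : L2) :
    ⟪negLapInv (h + k), h + k⟫ =
      ⟪negLapInv h, h⟫ + 2 * ⟪negLapInv h, k⟫ + ⟪negLapInv k, k⟫ := by
  have hh := continuous_flux h
  have hk := continuous_flux k
  simp_rw [inner_negLapInv, flux_add]
  rw [← intervalIntegral.integral_const_mul, ← intervalIntegral.integral_add,
    ← intervalIntegral.integral_add]
  · congr 1
    ext s
    ring
  all_goals exact Continuous.intervalIntegrable (by fun_prop) _ _

/-! ### Existence of `μ_c` and positivity of `μ_c(K)` -/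

instance : SecondCountableTopology L2 :=
  have : Fact ((2 : ℝ≥0∞) ≠ ∞) := ⟨by norm_num⟩
  inferInstance

theorem sum_smul_schauderL2_ae (s : Finset ℕ) (x : ℕ → ℝ) :
    ∀ᵐ θ ∂leb, (∑ n ∈ s, x n • schauderL2 n : L2) θ =
      ∑ n ∈ s, x n * schauder n θ - ∫ τ in (0 : ℝ)..1, ∑ n ∈ s, x n * schauder n τ := by
  classical
  have hi : ∀ n, IntervalIntegrable (fun τ => x n * schauder n τ) volume 0 1 := fun n =>
    (continuous_const.mul (continuous_schauder n)).intervalIntegrable _ _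
  rw [intervalIntegral.integral_finsetSum fun n _ => hi n]
  simp_rw [← Finset.sum_sub_distrib]
  induction s using Finset.induction_on with
  | empty =>
    filter_upwards [Lp.coeFn_zero ℝ 2 leb] with θ hθ
    simpa using hθ
  | insert n s hn ih =>
    rw [Finset.sum_insert hn]
    filter_upwards [ih, Lp.coeFn_add (x n • schauderL2 n) (∑ n ∈ s, x n • schauderL2 n),
      Lp.coeFn_smul (x n) (schauderL2 n), centeredL2_ae (continuous_schauder n)] with θ h1 h2 h3 h4
    rw [h2, Pi.add_apply, h1, h3, Pi.smul_apply, schauderL2, h4, Finset.sum_insert hn,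
      intervalIntegral.integral_const_mul, smul_eq_mul]
    ring

/-- Removing the average at most doubles a uniform bound. -/
theorem abs_sum_smul_schauderL2_le {s : Finset ℕ} {x : ℕ → ℝ} {C : ℝ}
    (hC : ∀ θ ∈ Icc (0 : ℝ) 1, |∑ n ∈ s, x n * schauder n θ| ≤ C) :
    ∀ᵐ θ ∂leb, |(∑ n ∈ s, x n • schauderL2 n : L2) θ| ≤ 2 * C := by
  have h1 : |∫ τ in (0 : ℝ)..1, ∑ n ∈ s, x n * schauder n τ| ≤ C := by
    have := intervalIntegral.norm_integral_le_of_norm_le_const (a := 0) (b := 1)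
      (f := fun τ => ∑ n ∈ s, x n * schauder n τ) (C := C) fun τ hτ => by
        rw [uIoc_of_le zero_le_one] at hτ
        exact hC τ (Ioc_subset_Icc_self hτ)
    simpa using this
  filter_upwards [sum_smul_schauderL2_ae s x, ae_restrict_mem measurableSet_Ioo] with θ h2 h3
  rw [h2]
  have := hC θ (Ioo_subset_Icc_self h3)
  refine (abs_sub _ _).trans ?_
  linarith

theorem norm_L2_le_of_ae_bound {u : L2} {C : ℝ} (hC : 0 ≤ C) (h : ∀ᵐ θ ∂leb, |u θ| ≤ C) :
    ‖u‖ ≤ C := by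
  have := Lp.norm_le_of_ae_bound (f := u) hC (h : ∀ᵐ θ ∂leb, ‖u θ‖ ≤ C)
  have h1 : measureUnivNNReal leb = 1 := by simp [measureUnivNNReal]
  simpa [h1] using this

/-- The Faber–Schauder expansion with independent standard normal coefficients converges almost
surely: eventually all coefficients satisfy the box constraints, so that the contributions of the
levels decay geometrically. -/
theorem ae_exists_tendsto_schauder :
    ∀ᵐ ω ∂stdGaussianSeq, ∃ l : L2,
      Tendsto (fun J => ∑ n ∈ Finset.range (2 ^ J), ω n • schauderL2 n) atTop (𝓝 l) := by
  filter_upwards [ae_eventually_abs_le (tsum_boxWidth_ne_top one_pos)] with ω hω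
  obtain ⟨N, hN⟩ := eventually_atTop.1 hω
  refine cauchySeq_tendsto_of_complete (cauchySeq_of_summable_dist ?_)
  refine Summable.of_norm_bounded_eventually_nat (g := fun j => 2 * quarterRoot⁻¹ ^ j)
    ((summable_geometric_of_lt_one quarterRoot_inv_pos.le quarterRoot_inv_lt_one).mul_left 2) ?_
  filter_upwards [eventually_ge_atTop N] with j hj
  rw [Real.norm_eq_abs, abs_of_nonneg dist_nonneg, dist_comm, dist_eq_norm, Nat.succ_eq_add_one,
    sum_range_two_pow_succ, add_sub_cancel_left]
  have hNj : N ≤ 2 ^ j := hj.trans Nat.lt_two_pow_self.le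
  set s : Finset ℕ := (Finset.range (2 ^ j)).map (addLeftEmbedding (2 ^ j)) with hs
  have e1 : ∑ k ∈ Finset.range (2 ^ j), ω (2 ^ j + k) • schauderL2 (2 ^ j + k) =
      ∑ n ∈ s, ω n • schauderL2 n := by simp [hs]
  rw [e1]
  refine norm_L2_le_of_ae_bound (mul_nonneg zero_le_two (pow_nonneg quarterRoot_inv_pos.le _))
    (abs_sum_smul_schauderL2_le fun θ hθ => ?_)
  have := abs_sum_schauder_level_le (ε := 1) hθ.1 (j := j) (x := ω) fun k _ => hN _ (by omega)
  simpa [hs] using this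

theorem exists_schauder_limit : ∃ X : (ℕ → ℝ) → L2, Measurable X ∧ ∀ᵐ ω ∂stdGaussianSeq,
    Tendsto (fun J => ∑ n ∈ Finset.range (2 ^ J), ω n • schauderL2 n) atTop (𝓝 (X ω)) :=
  measurable_limit_of_tendsto_metrizable_ae (fun _ => (Finset.measurable_fun_sum _ fun n _ =>
    (measurable_pi_apply n).smul_const (schauderL2 n)).aemeasurable) ae_exists_tendsto_schauder

theorem gaussian_spec {E : Type*} [NormedAddCommGroup E] [InnerProductSpace ℝ E]
    [MeasurableSpace E] [BorelSpace E] {m : E} {Q : E → E} {μ : Measure E}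
    (h : IsGaussianWith m Q μ) : IsGaussianWith m Q (gaussian m Q) := by
  have hex : ∃ μ : Measure E, IsGaussianWith m Q μ := ⟨μ, h⟩
  rw [gaussian, dif_pos hex]
  exact hex.choose_spec

theorem isGaussianWith_schauder (c : ℝ) {X : (ℕ → ℝ) → L2} (hX : Measurable X)
    (hlim : ∀ᵐ ω ∂stdGaussianSeq,
      Tendsto (fun J => ∑ n ∈ Finset.range (2 ^ J), ω n • schauderL2 n) atTop (𝓝 (X ω))) :
    IsGaussianWith (constL2 c) negLapInv (stdGaussianSeq.map fun ω => constL2 c + X ω) :=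
  isGaussianWith_map_series hX hlim tendsto_sum_inner_schauderL2_sq inner_negLapInv_smul
    inner_negLapInv_add

theorem isGaussianWith_mu (c : ℝ) : IsGaussianWith (constL2 c) negLapInv (mu c) := by
  obtain ⟨X, hX, hlim⟩ := exists_schauder_limit
  exact gaussian_spec (isGaussianWith_schauder c hX hlim)

instance isProbabilityMeasure_mu (c : ℝ) : IsProbabilityMeasure (mu c) :=
  have := (isGaussianWith_mu c).isGaussian
  inferInstance

theorem K_eq_Icc : K = Icc (constL2 (-1)) (constL2 1) := by
  ext x
  rw [mem_Icc, ← Lp.coeFn_le, ← Lp.coeFn_le]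
  constructor
  · intro h
    constructor
    · filter_upwards [h, constL2_ae (-1)] with s h1 h2
      rw [h2]; exact h1.1
    · filter_upwards [h, constL2_ae 1] with s h1 h2
      rw [h2]; exact h1.2
  · rintro ⟨h1, h2⟩
    filter_upwards [h1, h2, constL2_ae (-1), constL2_ae 1] with s h1 h2 h3 h4
    rw [h3] at h1
    rw [h4] at h2
    exact ⟨h1, h2⟩

theorem isClosed_K : IsClosed K := K_eq_Icc ▸ isClosed_Icc

/-- When all coefficients satisfy sufficiently narrow box constraints, the random series stays
within distance `1 - |c|` of its mean `c`. -/
theorem mu_K_pos {c : ℝ} (hc₁ : -1 < c) (hc₂ : c < 1) : 0 < mu c K := by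
  obtain ⟨X, hX, hlim⟩ := exists_schauder_limit
  have hμ : mu c = stdGaussianSeq.map fun ω => constL2 c + X ω :=
    (isGaussianWith_mu c).unique (isGaussianWith_schauder c hX hlim)
  set C := 1 + (1 - quarterRoot⁻¹)⁻¹ with hC
  have hCpos : 0 < C := by
    have : 0 < (1 - quarterRoot⁻¹)⁻¹ := inv_pos.2 (sub_pos.2 quarterRoot_inv_lt_one)
    linarith
  -- the series and its average are at most `ε * C` each in absolute value
  set ε := (1 - |c|) / (2 * C) with hε
  have hcabs : |c| < 1 := abs_lt.2 ⟨hc₁, hc₂⟩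
  have hεpos : 0 < ε := div_pos (by linarith) (by positivity)
  have hεC : 2 * (ε * C) = 1 - |c| := by rw [hε]; field_simp
  rw [hμ, Measure.map_apply (hX.const_add _) isClosed_K.measurableSet]
  refine (stdGaussianSeq_box_pos (boxWidth_pos hεpos) (tsum_boxWidth_ne_top hεpos)).trans_le
    (measure_mono_ae ?_)
  filter_upwards [hlim] with ω hω hbox
  refine isClosed_K.mem_of_tendsto (hω.const_add (constL2 c)) (Eventually.of_forall fun J => ?_)
  filter_upwards [abs_sum_smul_schauderL2_le fun θ hθ => abs_sum_schauder_le hθ hbox J,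
    Lp.coeFn_add (constL2 c) (∑ n ∈ Finset.range (2 ^ J), ω n • schauderL2 n), constL2_ae c]
    with θ h1 h2 h3
  rw [h2, Pi.add_apply, h3]
  rw [hεC] at h1
  have := abs_le.1 h1
  constructor
  · linarith [neg_abs_le c]
  · linarith [le_abs_self c]

/-! ### The potentials -/

/-- The even power series of which `Fⁿ + (λ/2) x²` is the partial sum. -/
def seriesTerm (x : ℝ) (k : ℕ) : ℝ :=
  2 * (x ^ (2 * k + 2) / ((2 * (k : ℝ) + 2) * (2 * (k : ℝ) + 1)))

/-- The entropy part `(1 + x) ln (1 + x) + (1 - x) ln (1 - x)` of `F`. -/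
def entropy (x : ℝ) : ℝ := (1 + x) * Real.log (1 + x) + (1 - x) * Real.log (1 - x)

theorem Fn_eq (lam : ℝ) (n : ℕ) (x : ℝ) :
    Fn lam n x = ∑ k ∈ Finset.range (n + 1), seriesTerm x k - lam / 2 * x ^ 2 := by
  rw [Fn, Finset.mul_sum]; rfl

theorem F_eq (lam x : ℝ) : F lam x = entropy x - lam / 2 * x ^ 2 := rfl

theorem seriesTerm_nonneg (x : ℝ) (k : ℕ) : 0 ≤ seriesTerm x k := by
  have : 0 ≤ x ^ (2 * k + 2) := Even.pow_nonneg ⟨k + 1, by ring⟩ x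
  unfold seriesTerm
  positivity

theorem continuous_Fn (lam : ℝ) (n : ℕ) : Continuous (Fn lam n) := by
  unfold Fn; fun_prop

theorem monotone_Fn (lam x : ℝ) : Monotone fun n => Fn lam n x := by
  refine monotone_nat_of_le_succ fun n => ?_
  rw [Fn_eq, Fn_eq, Finset.sum_range_succ _ (n + 1)]
  linarith [seriesTerm_nonneg x (n + 1)]

/-- A constant `C` with `-C ≤ Fⁿ` for all `n ≥ 1`: the quartic term of `Fⁿ` absorbs the
quadratic one. -/
def lowerBound (lam : ℝ) : ℝ := 3 / 8 * lam ^ 2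

theorem Fn_add_lowerBound_nonneg (lam : ℝ) {n : ℕ} (hn : 1 ≤ n) (x : ℝ) :
    0 ≤ Fn lam n x + lowerBound lam := by
  have h1 : Fn lam 1 x ≤ Fn lam n x := monotone_Fn lam x hn
  have h2 : Fn lam 1 x = x ^ 2 + x ^ 4 / 6 - lam / 2 * x ^ 2 := by
    rw [Fn]; simp [Finset.sum_range_succ]; ring
  unfold lowerBound
  nlinarith [sq_nonneg (x ^ 2 - 3 / 2 * lam), sq_nonneg x]

theorem continuous_entropy : Continuous entropy := by
  have h := Real.continuous_mul_log
  exact (h.comp (continuous_const.add continuous_id)).add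
    (h.comp (continuous_const.sub continuous_id))

theorem continuous_F (lam : ℝ) : Continuous (F lam) :=
  continuous_entropy.sub (by fun_prop)

theorem hasSum_seriesTerm_of_abs_lt_one {x : ℝ} (hx : |x| < 1) :
    HasSum (seriesTerm x) (entropy x) := by
  have hx' := abs_lt.1 hx
  have hx2 : |x ^ 2| < 1 := by
    rw [abs_pow]; exact pow_lt_one₀ (abs_nonneg x) hx two_ne_zero
  have h1 := (Real.hasSum_pow_div_log_of_abs_lt_one hx2).neg
  have h2 := (Real.hasSum_log_sub_log_of_abs_lt_one hx).mul_left x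
  have hlog : Real.log (1 - x ^ 2) = Real.log (1 + x) + Real.log (1 - x) := by
    rw [← Real.log_mul (by linarith) (by linarith)]; ring_nf
  have hsum : -(-Real.log (1 - x ^ 2)) + x * (Real.log (1 + x) - Real.log (1 - x)) =
      entropy x := by
    rw [neg_neg, hlog, entropy]; ring
  have h3 := h1.add h2
  rw [hsum] at h3
  refine h3.congr_fun fun k => ?_
  have a1 : (2 * (k : ℝ) + 2) ≠ 0 := by positivity
  have a2 : (2 * (k : ℝ) + 1) ≠ 0 := by positivity
  have a3 : ((k : ℝ) + 1) ≠ 0 := by positivity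
  rw [seriesTerm, ← pow_mul]
  field_simp
  ring

theorem seriesTerm_neg (x : ℝ) : seriesTerm (-x) = seriesTerm x := by
  ext k
  rw [seriesTerm, Even.neg_pow ⟨k + 1, by ring⟩, seriesTerm]

theorem entropy_neg (x : ℝ) : entropy (-x) = entropy x := by
  unfold entropy; rw [sub_neg_eq_add, ← sub_eq_add_neg]; ring

/-- At the endpoint the series is handled by monotonicity in `n` and continuity in `x`. -/
theorem hasSum_seriesTerm_one : HasSum (seriesTerm 1) (entropy 1) := by
  rw [hasSum_iff_tendsto_nat_of_nonneg (seriesTerm_nonneg 1)]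
  have hcont : ∀ n, Continuous fun x => ∑ k ∈ Finset.range n, seriesTerm x k := fun n => by
    unfold seriesTerm; fun_prop
  have hent : Tendsto entropy (𝓝[<] 1) (𝓝 (entropy 1)) :=
    (continuous_entropy.tendsto 1).mono_left nhdsWithin_le_nhds
  have hIoo : ∀ᶠ x in 𝓝[<] (1 : ℝ), x ∈ Ioo (0 : ℝ) 1 := Ioo_mem_nhdsLT one_pos
  refine tendsto_atTop_isLUB (monotone_nat_of_le_succ fun n => ?_) ⟨?_, fun b hb => ?_⟩
  · rw [Finset.sum_range_succ]
    linarith [seriesTerm_nonneg 1 n]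
  · rintro _ ⟨n, rfl⟩
    refine le_of_tendsto_of_tendsto (((hcont n).tendsto 1).mono_left nhdsWithin_le_nhds) hent ?_
    filter_upwards [hIoo] with x hx
    exact sum_le_hasSum _ (fun k _ => seriesTerm_nonneg x k)
      (hasSum_seriesTerm_of_abs_lt_one (abs_lt.2 ⟨by linarith [hx.1], hx.2⟩))
  · refine le_of_tendsto hent ?_
    filter_upwards [hIoo] with x hx
    refine le_of_tendsto'
      (hasSum_seriesTerm_of_abs_lt_one (abs_lt.2 ⟨by linarith [hx.1], hx.2⟩)).tendsto_sum_nat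
      fun n => le_trans (Finset.sum_le_sum fun k _ => ?_) (hb ⟨n, rfl⟩)
    unfold seriesTerm
    gcongr
    · exact hx.1.le
    · exact hx.2.le

theorem hasSum_seriesTerm {x : ℝ} (hx : |x| ≤ 1) : HasSum (seriesTerm x) (entropy x) := by
  rcases hx.lt_or_eq with h | h
  · exact hasSum_seriesTerm_of_abs_lt_one h
  · rcases eq_or_eq_neg_of_abs_eq h with rfl | rfl
    · exact hasSum_seriesTerm_one
    · rw [seriesTerm_neg, entropy_neg]
      exact hasSum_seriesTerm_one

theorem tendsto_Fn {lam x : ℝ} (hx : |x| ≤ 1) :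
    Tendsto (fun n => Fn lam n x) atTop (𝓝 (F lam x)) := by
  simp_rw [Fn_eq, F_eq]
  exact ((tendsto_add_atTop_iff_nat 1).2 (hasSum_seriesTerm hx).tendsto_sum_nat).sub_const _

/-- Outside `[-1, 1]` already the last term of the partial sum diverges. -/
theorem tendsto_Fn_atTop {lam x : ℝ} (hx : 1 < |x|) :
    Tendsto (fun n => Fn lam n x) atTop atTop := by
  have hr : 1 < x ^ 2 := by
    rw [← sq_abs]; exact one_lt_pow₀ hx two_ne_zero
  have h0 := tendsto_pow_const_div_const_pow_of_one_lt 2 hr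
  have h1 : Tendsto (fun n : ℕ => (((n + 1 : ℕ) : ℝ) ^ 2 / (x ^ 2) ^ (n + 1))⁻¹) atTop atTop := by
    refine Tendsto.inv_tendsto_nhdsGT_zero (tendsto_nhdsWithin_iff.2
      ⟨(tendsto_add_atTop_iff_nat 1).2 h0, Eventually.of_forall fun n => ?_⟩)
    rw [mem_Ioi]
    positivity
  have h2 := tendsto_atTop_add_const_right atTop (-(lam / 2 * x ^ 2))
    (h1.const_mul_atTop (by norm_num : (0 : ℝ) < 1 / 2))
  refine tendsto_atTop_mono (fun n => ?_) h2
  rw [Fn_eq, sub_eq_add_neg]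
  gcongr
  rw [Finset.sum_range_succ]
  have h3 : 1 / 2 * (((n + 1 : ℕ) : ℝ) ^ 2 / (x ^ 2) ^ (n + 1))⁻¹ ≤ seriesTerm x n := by
    rw [inv_div, seriesTerm, ← pow_mul, mul_add, mul_one]
    push_cast
    have : 0 ≤ x ^ (2 * n + 2) := Even.pow_nonneg ⟨n + 1, by ring⟩ x
    rw [div_mul_div_comm, one_mul, mul_div_assoc', div_le_div_iff₀ (by positivity) (by positivity)]
    nlinarith [mul_nonneg this (Nat.cast_nonneg (α := ℝ) n)]
  have := Finset.sum_nonneg fun k (_ : k ∈ Finset.range n) => seriesTerm_nonneg x k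
  linarith

theorem F_add_lowerBound_nonneg (lam : ℝ) {x : ℝ} (hx : |x| ≤ 1) :
    0 ≤ F lam x + lowerBound lam := by
  refine ge_of_tendsto ((tendsto_Fn hx).add_const _) ?_
  filter_upwards [eventually_ge_atTop 1] with n hn
  exact Fn_add_lowerBound_nonneg lam hn x

/-! ### The Gibbs weights -/

/-- `exp (-t)` for `t ∈ [0, ∞]`. -/
def expNeg (t : ℝ≥0∞) : ℝ≥0∞ := EReal.exp (-(t : EReal))

theorem continuous_expNeg : Continuous expNeg :=
  EReal.expHomeomorph.continuous.comp (continuous_neg.comp continuous_coe_ennreal_ereal)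

theorem expNeg_top : expNeg ∞ = 0 := by simp [expNeg]

theorem expNeg_le_one (t : ℝ≥0∞) : expNeg t ≤ 1 := by
  rw [expNeg, EReal.exp_le_one_iff, EReal.neg_le, neg_zero]
  exact EReal.coe_ennreal_nonneg t

theorem ofReal_exp_mul_expNeg {C r : ℝ} (h : 0 ≤ r + C) :
    ENNReal.ofReal (Real.exp C) * expNeg (ENNReal.ofReal (r + C)) =
      EReal.exp (-(r : EReal)) := by
  rw [expNeg, EReal.coe_ennreal_ofReal, max_eq_left h, ← EReal.coe_neg, ← EReal.coe_neg,
    EReal.exp_coe, EReal.exp_coe, ← ENNReal.ofReal_mul (Real.exp_nonneg _), ← Real.exp_add]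
  ring_nf

/-- The functional `∫₀¹ (Fⁿ(x(θ)) + C) dθ`, with values in `[0, ∞]` when `-C` is the lower bound
of `Fⁿ`. -/
def energy (lam : ℝ) (n : ℕ) (x : L2) : ℝ≥0∞ :=
  ∫⁻ θ, ENNReal.ofReal (Fn lam n (x θ) + lowerBound lam) ∂leb

theorem ae_measurable_comp_L2 {β : Type*} [MeasurableSpace β] {g : ℝ → β} (hg : Measurable g)
    (x : L2) : AEMeasurable (fun θ => g (x θ)) leb :=
  hg.comp_aemeasurable (Lp.aestronglyMeasurable x).aemeasurable

/-- Integral functionals with nonnegative continuous integrand are lower semicontinuous on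
`L²(0,1)`, by Fatou's lemma along an almost everywhere convergent subsequence. -/
theorem lowerSemicontinuous_lintegral_comp {g : ℝ → ℝ≥0∞} (hg : Continuous g) :
    LowerSemicontinuous fun x : L2 => ∫⁻ θ, g (x θ) ∂leb := by
  rw [lowerSemicontinuous_iff_isClosed_preimage]
  intro y
  refine IsSeqClosed.isClosed fun u x hu hx => ?_
  obtain ⟨φ, -, hφ⟩ := (tendstoInMeasure_of_tendsto_Lp hx).exists_seq_tendsto_ae
  have h1 : ∫⁻ θ, g (x θ) ∂leb ≤ ∫⁻ θ, liminf (fun i => g (u (φ i) θ)) atTop ∂leb := by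
    refine lintegral_mono_ae ?_
    filter_upwards [hφ] with θ hθ
    exact ((hg.tendsto _).comp hθ).liminf_eq.ge
  refine h1.trans ((lintegral_liminf_le' fun i =>
    ae_measurable_comp_L2 hg.measurable _).trans ?_)
  exact liminf_le_of_le (by isBoundedDefault) fun b hb => by
    obtain ⟨i, hi⟩ := hb.exists
    exact hi.trans (hu (φ i))

theorem measurable_energy (lam : ℝ) (n : ℕ) : Measurable (energy lam n) :=
  (lowerSemicontinuous_lintegral_comp (ENNReal.continuous_ofReal.comp
    ((continuous_Fn lam n).add continuous_const))).measurable

theorem exp_neg_Un (lam : ℝ) {n : ℕ} (hn : 1 ≤ n) (x : L2) :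
    EReal.exp (-Un lam n x) =
      ENNReal.ofReal (Real.exp (lowerBound lam)) * expNeg (energy lam n x) := by
  have hm : AEStronglyMeasurable (fun θ => Fn lam n (x θ) + lowerBound lam) leb :=
    ((continuous_Fn lam n).add continuous_const).comp_aestronglyMeasurable
      (Lp.aestronglyMeasurable x)
  have h0 : ∀ θ, 0 ≤ Fn lam n (x θ) + lowerBound lam := fun θ =>
    Fn_add_lowerBound_nonneg lam hn _
  by_cases hi : Integrable (fun θ => Fn lam n (x θ)) leb
  · have hint : ∫ θ, (Fn lam n (x θ) + lowerBound lam) ∂leb =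
        ∫ θ, Fn lam n (x θ) ∂leb + lowerBound lam := by
      rw [integral_add hi (integrable_const _)]
      simp [Measure.real]
    have hi' : Integrable (fun θ => Fn lam n (x θ) + lowerBound lam) leb :=
      hi.add (integrable_const _)
    rw [Un, if_pos hi, energy, ← ofReal_integral_eq_lintegral_ofReal hi'
      (Eventually.of_forall h0), hint, ofReal_exp_mul_expNeg]
    rw [← hint]
    exact integral_nonneg h0
  · have htop : energy lam n x = ∞ := by
      by_contra h
      have h2 := ((lintegral_ofReal_ne_top_iff_integrable hm (Eventually.of_forall h0)).1 h).sub
        (integrable_const (lowerBound lam))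
      exact hi (h2.congr (Eventually.of_forall fun θ => by simp))
    rw [Un, if_neg hi, htop, expNeg_top]
    simp

theorem abs_le_of_mem_K {x : L2} (hx : x ∈ K) : ∀ᵐ θ ∂leb, |x θ| ≤ 1 := by
  filter_upwards [hx] with θ hθ
  exact abs_le.2 hθ

theorem integrable_comp_of_mem_K {x : L2} (hx : x ∈ K) {f : ℝ → ℝ} (hf : Continuous f) :
    Integrable (fun θ => f (x θ)) leb := by
  obtain ⟨C, hC⟩ := (isCompact_Icc (a := (-1 : ℝ)) (b := 1)).exists_bound_of_continuousOn
    hf.continuousOn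
  refine Integrable.of_bound (hf.comp_aestronglyMeasurable (Lp.aestronglyMeasurable x)) C ?_
  filter_upwards [hx] with θ hθ
  exact hC _ hθ

/-- The weights of `νⁿ` converge pointwise to the weight of `ν`, by monotone convergence of the
energies, whose limit is infinite off `K`. -/
theorem tendsto_expNeg_energy (lam : ℝ) (x : L2) :
    Tendsto (fun n => ENNReal.ofReal (Real.exp (lowerBound lam)) * expNeg (energy lam n x)) atTop
      (𝓝 (K.indicator (fun x => EReal.exp (-U lam x)) x)) := by
  classical
  -- the pointwise limit of `Fⁿ + C`
  set Φ : ℝ → ℝ≥0∞ := fun y =>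
    if |y| ≤ 1 then ENNReal.ofReal (F lam y + lowerBound lam) else ∞ with hΦ
  have hΦm : Measurable Φ := Measurable.ite (measurableSet_le measurable_id.abs measurable_const)
    ((continuous_F lam).measurable.add_const _).ennreal_ofReal measurable_const
  have hlim : Tendsto (fun n => energy lam n x) atTop (𝓝 (∫⁻ θ, Φ (x θ) ∂leb)) := by
    refine lintegral_tendsto_of_tendsto_of_monotone (fun n => ae_measurable_comp_L2
      (((continuous_Fn lam n).measurable.add_const _).ennreal_ofReal) x)
      (Eventually.of_forall fun θ n m hnm => ENNReal.ofReal_le_ofReal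
        (by linarith [monotone_Fn lam (x θ) hnm])) (Eventually.of_forall fun θ => ?_)
    by_cases h : |x θ| ≤ 1
    · simp only [hΦ, if_pos h]
      exact (ENNReal.continuous_ofReal.tendsto _).comp ((tendsto_Fn h).add_const _)
    · simp only [hΦ, if_neg h]
      exact ENNReal.tendsto_ofReal_atTop.comp
        (tendsto_atTop_add_const_right _ _ (tendsto_Fn_atTop (not_le.1 h)))
  have hlim2 := ENNReal.Tendsto.const_mul (a := ENNReal.ofReal (Real.exp (lowerBound lam)))
    ((continuous_expNeg.tendsto _).comp hlim) (Or.inr ENNReal.ofReal_ne_top)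
  suffices h : K.indicator (fun x => EReal.exp (-U lam x)) x =
      ENNReal.ofReal (Real.exp (lowerBound lam)) * expNeg (∫⁻ θ, Φ (x θ) ∂leb) by
    rw [h]; exact hlim2
  by_cases hx : x ∈ K
  · have hi := integrable_comp_of_mem_K hx (continuous_F lam)
    have h0 : ∀ᵐ θ ∂leb, 0 ≤ F lam (x θ) + lowerBound lam := by
      filter_upwards [abs_le_of_mem_K hx] with θ hθ
      exact F_add_lowerBound_nonneg lam hθ
    have hint : ∫ θ, (F lam (x θ) + lowerBound lam) ∂leb =
        ∫ θ, F lam (x θ) ∂leb + lowerBound lam := by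
      rw [integral_add hi (integrable_const _)]
      simp [Measure.real]
    have e1 : ∫⁻ θ, Φ (x θ) ∂leb =
        ENNReal.ofReal (∫ θ, F lam (x θ) ∂leb + lowerBound lam) := by
      have hi' : Integrable (fun θ => F lam (x θ) + lowerBound lam) leb :=
        hi.add (integrable_const _)
      rw [← hint, ofReal_integral_eq_lintegral_ofReal hi' h0]
      refine lintegral_congr_ae ?_
      filter_upwards [abs_le_of_mem_K hx] with θ hθ
      simp only [hΦ, if_pos hθ]
    rw [indicator_of_mem hx, U, if_pos hx, e1, ofReal_exp_mul_expNeg]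
    rw [← hint]
    exact integral_nonneg_of_ae h0
  · have e1 : ∫⁻ θ, Φ (x θ) ∂leb = ∞ := by
      refine lintegral_eq_top_of_measure_eq_top_ne_zero (ae_measurable_comp_L2 hΦm x) fun h => hx ?_
      have : ∀ᵐ θ ∂leb, ¬ Φ (x θ) = ∞ := by
        rw [ae_iff]; simpa only [not_not] using h
      filter_upwards [this] with θ hθ
      by_contra hcon
      refine hθ (if_neg fun h' => hcon (abs_le.1 h'))
    rw [indicator_of_notMem hx, e1, expNeg_top, mul_zero]

/-! ### Normalized measures -/

theorem isProbabilityMeasure_normalized {μ : Measure L2} {w : L2 → ℝ≥0∞}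
    (h0 : ∫⁻ x, w x ∂μ ≠ 0) (htop : ∫⁻ x, w x ∂μ ≠ ∞) :
    IsProbabilityMeasure (normalized μ w) := by
  refine ⟨?_⟩
  rw [normalized, Measure.smul_apply, withDensity_apply _ MeasurableSet.univ,
    Measure.restrict_univ, smul_eq_mul, ENNReal.inv_mul_cancel h0 htop]

theorem lintegral_ne_zero_of_pos_on {μ : Measure L2} {w : L2 → ℝ≥0∞} (hw : Measurable w)
    {s : Set L2} (hs : 0 < μ s) (hpos : ∀ x ∈ s, w x ≠ 0) : ∫⁻ x, w x ∂μ ≠ 0 := by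
  intro h
  rw [lintegral_eq_zero_iff hw] at h
  refine hs.ne' (measure_mono_null (fun x hx => ?_) (ae_iff.1 h))
  exact hpos x hx

/-- Normalized measures converge weakly when their densities converge boundedly and pointwise. -/
theorem tendsto_integral_normalized {μ : Measure L2} [IsFiniteMeasure μ] {w : ℕ → L2 → ℝ≥0∞}
    {w' : L2 → ℝ≥0∞} {B : ℝ≥0∞} (hB : B ≠ ∞) (hw : ∀ n, Measurable (w n)) (hw' : Measurable w')
    (hwB : ∀ n x, w n x ≤ B) (hlim : ∀ x, Tendsto (fun n => w n x) atTop (𝓝 (w' x)))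
    (h0 : ∫⁻ x, w' x ∂μ ≠ 0) (ψ : L2 →ᵇ ℝ) :
    Tendsto (fun n => ∫ x, ψ x ∂(normalized μ (w n))) atTop
      (𝓝 (∫ x, ψ x ∂(normalized μ w'))) := by
  have hwB' : ∀ x, w' x ≤ B := fun x => le_of_tendsto' (hlim x) fun n => hwB n x
  have hBint : ∫⁻ _, B ∂μ ≠ ∞ := by
    rw [lintegral_const]; exact ENNReal.mul_ne_top hB (measure_ne_top _ _)
  have hform : ∀ v : L2 → ℝ≥0∞, Measurable v → (∀ x, v x ≤ B) →
      ∫ x, ψ x ∂(normalized μ v) =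
        (∫⁻ x, v x ∂μ)⁻¹.toReal * ∫ x, (v x).toReal * ψ x ∂μ := by
    intro v hv hvB
    rw [normalized, integral_smul_measure, integral_withDensity_eq_integral_toReal_smul hv
      (Eventually.of_forall fun x => (hvB x).trans_lt hB.lt_top)]
    simp
  rw [hform w' hw' hwB']
  simp_rw [fun n => hform (w n) (hw n) (hwB n)]
  have hZ : Tendsto (fun n => ∫⁻ x, w n x ∂μ) atTop (𝓝 (∫⁻ x, w' x ∂μ)) :=
    tendsto_lintegral_of_dominated_convergence (fun _ => B) hw
      (fun n => Eventually.of_forall (hwB n)) hBint (Eventually.of_forall hlim)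
  refine Tendsto.mul ((ENNReal.tendsto_toReal (ENNReal.inv_ne_top.2 h0)).comp hZ.inv) ?_
  refine tendsto_integral_of_dominated_convergence (fun _ => B.toReal * ‖ψ‖) (fun n => ?_)
    (integrable_const _) (fun n => Eventually.of_forall fun x => ?_)
    (Eventually.of_forall fun x => ?_)
  · exact ((hw n).ennreal_toReal.mul ψ.continuous.measurable).aestronglyMeasurable
  · rw [norm_mul, Real.norm_of_nonneg ENNReal.toReal_nonneg]
    exact mul_le_mul (ENNReal.toReal_mono hB (hwB n x)) (ψ.norm_coe_le_norm x) (norm_nonneg _)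
      ENNReal.toReal_nonneg
  · exact ((ENNReal.tendsto_toReal ((hwB' x).trans_lt hB.lt_top).ne).comp (hlim x)).mul_const _

end CahnHilliard

end

open CahnHilliard in
theorem proposition2p2 (lam c : ℝ) (hc₁ : -1 < c) (hc₂ : c < 1) :
    CahnHilliard.IsGaussianWith (CahnHilliard.constL2 c) CahnHilliard.negLapInv
      (CahnHilliard.mu c) ∧
    0 < CahnHilliard.mu c CahnHilliard.K ∧
    (∀ n : ℕ, 1 ≤ n → IsProbabilityMeasure (CahnHilliard.nuN lam c n)) ∧
    IsProbabilityMeasure (CahnHilliard.nu lam c) ∧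
    ∀ ψ : CahnHilliard.L2 →ᵇ ℝ,
      Tendsto (fun n : ℕ => ∫ x, ψ x ∂(CahnHilliard.nuN lam c n)) atTop
        (𝓝 (∫ x, ψ x ∂(CahnHilliard.nu lam c))) := by
  have hK := mu_K_pos hc₁ hc₂
  set B := ENNReal.ofReal (Real.exp (lowerBound lam)) with hB
  have hBtop : B ≠ ∞ := ENNReal.ofReal_ne_top
  set w : ℕ → L2 → ℝ≥0∞ := fun n x => B * expNeg (energy lam n x) with hw
  set w' : L2 → ℝ≥0∞ := K.indicator fun x => EReal.exp (-U lam x) with hw'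
  have hwm : ∀ n, Measurable (w n) := fun n =>
    (continuous_expNeg.measurable.comp (measurable_energy lam n)).const_mul B
  have hlim : ∀ x, Tendsto (fun n => w n x) atTop (𝓝 (w' x)) := tendsto_expNeg_energy lam
  have hwm' : Measurable w' := measurable_of_tendsto_metrizable hwm (tendsto_pi_nhds.2 hlim)
  have hwB : ∀ n x, w n x ≤ B := fun n x =>
    (mul_le_mul_right (expNeg_le_one _) B).trans_eq (mul_one B)
  have hwB' : ∀ x, w' x ≤ B := fun x => le_of_tendsto' (hlim x) fun n => hwB n x
  have hfin : ∀ v : L2 → ℝ≥0∞, (∀ x, v x ≤ B) → ∫⁻ x, v x ∂(mu c) ≠ ∞ := fun v hv =>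
    ne_top_of_le_ne_top (by simpa using hBtop : ∫⁻ _, B ∂(mu c) ≠ ∞) (lintegral_mono hv)
  have hnu : ∀ n, 1 ≤ n → nuN lam c n = normalized (mu c) (w n) := fun n hn => by
    rw [nuN, show (fun x => EReal.exp (-Un lam n x)) = w n from funext (exp_neg_Un lam hn)]
  have hZ : ∀ n, 1 ≤ n → ∫⁻ x, w n x ∂(mu c) ≠ 0 := fun n hn =>
    lintegral_ne_zero_of_pos_on (hwm n) hK fun x hx => by
      rw [hw]
      simp only
      rw [hB, ← exp_neg_Un lam hn, Un, if_pos (integrable_comp_of_mem_K hx (continuous_Fn lam n)),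
        ← EReal.coe_neg, EReal.exp_coe]
      simp [Real.exp_pos]
  have hZ' : ∫⁻ x, w' x ∂(mu c) ≠ 0 :=
    lintegral_ne_zero_of_pos_on hwm' hK fun x hx => by
      rw [hw', indicator_of_mem hx, U, if_pos hx, ← EReal.coe_neg, EReal.exp_coe]
      simp [Real.exp_pos]
  refine ⟨isGaussianWith_mu c, hK, fun n hn => ?_, ?_, fun ψ => ?_⟩
  · rw [hnu n hn]
    exact isProbabilityMeasure_normalized (hZ n hn) (hfin _ (hwB n))
  · exact isProbabilityMeasure_normalized hZ' (hfin _ hwB')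
  · refine (tendsto_integral_normalized hBtop hwm hwm' hwB hlim hZ' ψ).congr' ?_
    -- `U⁰` need not be bounded below, so `w` is the weight of `νⁿ` for `n ≥ 1` only
    filter_upwards [eventually_ge_atTop 1] with n hn
    rw [hnu n hn]
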